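/- Model. A connected graph $G=(V,E)$ with $n$ vertices and diameter $D$ is a synchronous network (the CONGEST model). The vertices carry arbitrary distinct identifiers of $O(\log n)$ bits. Initially each vertex knows only its own identifier and those of its neighbours. In every round each vertex draws private fair coins, may send one message of $O(\log n)$ bits to each of its neighbours, and performs unrestricted local computation; a vertex stops when it produces its output. The edge congestion of an algorithm is the worst-case total number of messages exchanged through a single edge during the whole execution. A vertex $x$ is a cut vertex if $G\setminus\{x\}$ is not connected. Theorem. There is a universal constant $k$ such that for every constant $a$ there is a constant $B$ such that for every constant $c$ there are a randomized algorithm and a constant $C$ with the following properties. On every connected graph $G$ with $n$ vertices, diameter $D$ and distinct identifiers of at most $a(\lfloor\log_2 n\rfloor+1)$ bits each: 1. every message has at most $B(\lfloor\log_2 n\rfloor+1)$ bits; 2. for every outcome of the coins, all vertices have stopped after at most $C\cdot D\cdot(\lfloor\log_2 n\rfloor+1)^k=\widetilde O(D)$ rounds; 3. for every outcome of the coins, at most $C(\lfloor\log_2 n\rfloor+1)^k=\widetilde O(1)$ messages are exchanged through each edge; 4. with probability at least $1-1/n^c$, the outputs of all vertices are correct, that is, every vertex $x\in V$ has learned whether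 it is a cut vertex. -/

import Mathlib

/-- A randomized distributed algorithm for synchronous message passing. A node starts with its own
identifier and the set of identifiers of its neighbours, and nothing else (in particular neither
the number of vertices nor the diameter, and there is no distinguished node). In each round a
running node draws fresh private fair coins (how many may depend on its state), chooses for each
neighbour, addressed by its identifier, a bit string or silence (`none`), and then updates its
state from the coins and the messages it received. Local computation is unrestricted. A node stops
as soon as `output` is not `none`, and the value is its final output. -/
structure DistAlg where
  /-- local states -/
  State : Type
  /-- initial state, from the own identifier and the identifiers of the neighbours -/
  init : ℕ → Finset ℕ → State
  /-- number of coins drawn in the next round -/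
  coins : State → ℕ
  /-- message to the neighbour with the given identifier -/
  send : (s : State) → (Fin (coins s) → Bool) → ℕ → Option (List Bool)
  /-- new state, from the coins and the received messages (indexed by the sender's identifier) -/
  recv : (s : State) → (Fin (coins s) → Bool) → (ℕ → Option (List Bool)) → State
  /-- final output, `none` while the node is still running -/
  output : State → Option Bool

/-- All coins of an execution: the `i`-th coin of vertex `v` in round `t` is `ω (v, t, i)`. -/
abbrev Coins (V : Type) : Type := V × ℕ × ℕ → Bool

/-- The coins are independent and fair. -/
noncomputable def coinMeasure (V : Type) : MeasureTheory.Measure (Coins V) :=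
  MeasureTheory.Measure.infinitePi fun _ => (PMF.uniformOfFintype Bool).toMeasure

namespace DistAlg

variable {V : Type} [Fintype V] (A : DistAlg) (G : SimpleGraph V) (ident : V → ℕ) (ω : Coins V)

open Classical in
/-- The message that `u` sends to `v` in round `t` when the current states are `s`; there is none
if `u` and `v` are not adjacent or `u` has stopped. -/
noncomputable def message (s : V → A.State) (t : ℕ) (u v : V) : Option (List Bool) :=
  if G.Adj u v ∧ A.output (s u) = none then
    A.send (s u) (fun i => ω (u, t, (i : ℕ))) (ident v)
  else none

open Classical in
/-- The states of all vertices after `t` rounds. -/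
noncomputable def run : ℕ → V → A.State
  | 0, v => A.init (ident v) ((Finset.univ.filter fun u => G.Adj v u).image ident)
  | t + 1, v =>
    if A.output (run t v) = none then
      A.recv (run t v) (fun i => ω (v, t, (i : ℕ)))
        (Function.extend ident (fun u => A.message G ident ω (run t) t u v) fun _ => none)
    else run t v

/-- The message sent from `u` to `v` in round `t` of the execution (rounds are numbered from 0). -/
noncomputable def sent (t : ℕ) (u v : V) : Option (List Bool) :=
  A.message G ident ω (A.run G ident ω t) t u v

/-- The number of messages exchanged, in both directions, through the edge `uv` in the first `T`
rounds. -/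
noncomputable def traffic (T : ℕ) (u v : V) : ℕ :=
  ∑ t ∈ Finset.range T, ((if (A.sent G ident ω t u v).isSome then 1 else 0) +
    (if (A.sent G ident ω t v u).isSome then 1 else 0))

end DistAlg

/-- `x` is a cut vertex of `G`: some two of the remaining vertices are not joined by a path in the
graph obtained by deleting `x`. -/
def IsCutVertex {V : Type} (G : SimpleGraph V) (x : V) : Prop :=
  ¬ (G.induce {x}ᶜ).Preconnected

/-! The algorithm draws no coins and is correct in every execution, so the probability bound is
immediate. It rests on two ideas.

Borůvka's algorithm at all vertices at once. Fix a breadth-first tree. Deleting `x` leaves connected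
parts: the subtrees of the children of `x` and, unless `x` is the root, everything outside the
subtree of `x`. So `x` is a cut vertex exactly when the edges of `G` between these parts fail to
join them all. Each `x` keeps a relation of known links between its parts and tries to find, for
every class of child subtrees not yet linked to the outside, an edge that leaves the class. A
subtree cannot afford a separate search for each ancestor, so it reports only two numbers to its
parent: the least and the greatest label among its vertices and their neighbours, edges to parents
omitted. These two numbers suffice because the tree is relabelled in preorder in every phase, each
vertex ordering its children class by class. The child subtrees of a class then fill one interval of
labels, and an edge leaving the class ends below or above the whole interval, so one of the two
extremal labels lies in another part. If `x` is not a cut vertex, every class not linked to the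
outside therefore at least doubles in size in each phase (`exists_newLink`, `ClassBound.newLink`).
After `L` phases with `n ≤ 2 ^ L` no such class remains. Links are always sound
(`SoundLink.newLink`), so a class that remains certifies a cut vertex (`isCutVertex_iff_link`). A
phase takes `O(d)` rounds in a tree of depth at most `d` and at most three messages per edge and
direction.

Guessing with verification. Neither `n` nor `D` is known, so trials are run for pairs `(d, L)` of
powers of two in order of the product `d * L`. A trial elects a leader bit by bit on the
identifiers, floods from the survivors for `d` rounds, and compares notes across edges; any
inconsistency starts an alarm. All vertices agree on whether the trial failed (`setup_spec`), and a
success always yields a genuine breadth-first tree, even if `d` is below the diameter. A failed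
trial sends few messages whatever `L` is, because the election is silent on bits above the
identifiers and the tree computation is silent without a tree. A successful one forces `D ≤ 2 * d`,
which bounds `L` through the bound on the product (`exists_execution`). -/

/-! ### Deterministic protocols as lists of rounds -/

/-- One synchronous round of a protocol whose messages are natural numbers. Both functions see the
identifier of the node and the identifiers of its neighbours. -/
structure Step (R : Type) where
  /-- message to the neighbour with the given identifier -/
  send : ℕ → Finset ℕ → R → ℕ → Option ℕ
  /-- new registers from the received messages -/
  recv : ℕ → Finset ℕ → R → (ℕ → Option ℕ) → R

section Network

variable {V : Type} [Fintype V] (G : SimpleGraph V) (ident : V → ℕ) {R : Type}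

open Classical in
/-- The identifiers of the neighbours of `v`. -/
noncomputable def nbrIds (v : V) : Finset ℕ :=
  (Finset.univ.filter fun u => G.Adj v u).image ident

open Classical in
/-- The message from `u` to `v` in a round executing `st`. -/
noncomputable def outgoing (st : Step R) (s : V → R) (u v : V) : Option ℕ :=
  if G.Adj u v then st.send (ident u) (nbrIds G ident u) (s u) (ident v) else none

/-- The messages received by `v`, indexed by the identifier of the sender. -/
noncomputable def inbox (st : Step R) (s : V → R) (v : V) : ℕ → Option ℕ :=
  Function.extend ident (fun u => outgoing G ident st s u v) fun _ => none

/-- The registers after a round executing `st`. -/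
noncomputable def Step.app (st : Step R) (s : V → R) (v : V) : R :=
  st.recv (ident v) (nbrIds G ident v) (s v) (inbox G ident st s v)

/-- The registers after executing a list of rounds. -/
noncomputable def exec (l : List (Step R)) (s : V → R) : V → R :=
  l.foldl (fun s st => st.app G ident s) s

/-- The messages from `u` to `v` during the execution of a list of rounds. -/
noncomputable def msgs : List (Step R) → (V → R) → V → V → List ℕ
  | [], _, _, _ => []
  | st :: l, s, u, v => (outgoing G ident st s u v).toList ++ msgs l (st.app G ident s) u v

@[simp] theorem exec_nil (s : V → R) : exec G ident [] s = s := rfl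

@[simp] theorem exec_cons (st : Step R) (l : List (Step R)) (s : V → R) :
    exec G ident (st :: l) s = exec G ident l (st.app G ident s) := rfl

theorem exec_append (l₁ l₂ : List (Step R)) (s : V → R) :
    exec G ident (l₁ ++ l₂) s = exec G ident l₂ (exec G ident l₁ s) := by
  simp [exec]

@[simp] theorem msgs_nil (s : V → R) (u v : V) : msgs G ident [] s u v = [] := rfl

@[simp] theorem msgs_cons (st : Step R) (l : List (Step R)) (s : V → R) (u v : V) :
    msgs G ident (st :: l) s u v =
      (outgoing G ident st s u v).toList ++ msgs G ident l (st.app G ident s) u v := rfl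

theorem msgs_append (l₁ l₂ : List (Step R)) (s : V → R) (u v : V) :
    msgs G ident (l₁ ++ l₂) s u v =
      msgs G ident l₁ s u v ++ msgs G ident l₂ (exec G ident l₁ s) u v := by
  induction l₁ generalizing s with
  | nil => rfl
  | cons st l ih => simp [ih]

variable {ident}

theorem inbox_ident (hid : Function.Injective ident) (st : Step R) (s : V → R) (u v : V) :
    inbox G ident st s v (ident u) = outgoing G ident st s u v := by
  simp [inbox, hid.extend_apply]

theorem inbox_eq_some (hid : Function.Injective ident) (st : Step R) (s : V → R) (v : V)
    (m x : ℕ) : inbox G ident st s v m = some x ↔ ∃ u, ident u = m ∧ G.Adj u v ∧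
      st.send (ident u) (nbrIds G ident u) (s u) (ident v) = some x := by
  by_cases h : ∃ u, ident u = m
  · obtain ⟨u, rfl⟩ := h
    rw [inbox_ident G hid, outgoing]
    constructor
    · intro h
      split_ifs at h with hA
      exact ⟨u, rfl, hA, h⟩
    · rintro ⟨w, hw, hA, h⟩
      obtain rfl := hid hw
      simp [hA, h]
  · rw [inbox, Function.extend_apply' _ _ _ h]
    simp only [reduceCtorEq, false_iff]
    rintro ⟨u, hu, -⟩
    exact h ⟨u, hu⟩

theorem mem_nbrIds (hid : Function.Injective ident) (u v : V) :
    ident u ∈ nbrIds G ident v ↔ G.Adj v u := by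
  simp [nbrIds, hid.eq_iff]

end Network

/-! ### Realising a stream of rounds as a distributed algorithm -/

/-- The number with the given binary digits, the least significant first. -/
def ofDigits2 : List Bool → ℕ
  | [] => 0
  | b :: l => Nat.bit b (ofDigits2 l)

theorem ofDigits2_bits (n : ℕ) : ofDigits2 n.bits = n := by
  induction n using Nat.binaryRec' with
  | zero => rfl
  | bit b n h ih => rw [Nat.bits_append_bit n b h, ofDigits2, ih]

/-- The local state of the algorithm executing a stream of rounds. -/
structure StreamState (R : Type) where
  /-- number of rounds executed so far -/
  clock : ℕ
  /-- own identifier -/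
  id : ℕ
  /-- identifiers of the neighbours -/
  nbrs : Finset ℕ
  /-- registers -/
  reg : R

/-- The deterministic algorithm executing a stream of rounds. -/
noncomputable def streamAlg {R : Type} (P : ℕ → Step R) (ini : Finset ℕ → R)
    (out : R → Option Bool) : DistAlg where
  State := StreamState R
  init i N := ⟨0, i, N, ini N⟩
  coins _ := 0
  send s _ m := ((P s.clock).send s.id s.nbrs s.reg m).map Nat.bits
  recv s _ I := ⟨s.clock + 1, s.id, s.nbrs,
    (P s.clock).recv s.id s.nbrs s.reg fun m => (I m).map ofDigits2⟩
  output s := out s.reg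

section Stream

variable {V : Type} [Fintype V] (G : SimpleGraph V) {ident : V → ℕ} {R : Type}
  (P : ℕ → Step R) (ini : Finset ℕ → R) (out : R → Option Bool)

variable (ident) in
/-- The registers after `t` rounds of the stream. -/
noncomputable def streamExec (t : ℕ) : V → R :=
  exec G ident ((List.range t).map P) fun v => ini (nbrIds G ident v)

theorem streamExec_succ (t : ℕ) : streamExec G ident P ini (t + 1) =
    (P t).app G ident (streamExec G ident P ini t) := by
  simp [streamExec, List.range_succ, exec_append]

theorem extend_map {α β γ δ : Type} {f : α → β} (hf : Function.Injective f) (g : α → Option γ)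
    (h : γ → δ) (b : β) : (Function.extend f g (fun _ => none) b).map h =
      Function.extend f (fun a => (g a).map h) (fun _ => none) b := by
  by_cases hb : ∃ a, f a = b
  · obtain ⟨a, rfl⟩ := hb
    simp [hf.extend_apply]
  · simp [Function.extend_apply' _ _ _ hb]

theorem message_stream (ω : Coins V) (s : V → StreamState R) (t : ℕ)
    (hs : ∀ v, (s v).clock = t ∧ (s v).id = ident v ∧ (s v).nbrs = nbrIds G ident v)
    (ho : ∀ v, out (s v).reg = none) (u v : V) :
    (streamAlg P ini out).message G ident ω s t u v =
      (outgoing G ident (P t) (fun v => (s v).reg) u v).map Nat.bits := by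
  obtain ⟨h1, h2, h3⟩ := hs u
  have : (streamAlg P ini out).output (s u) = none := ho u
  unfold DistAlg.message outgoing
  by_cases hA : G.Adj u v
  · simp only [hA, this, and_self, if_true]
    simp [streamAlg, h1, h2, h3]
  · simp [hA]

/-- Encoding by `Nat.bits` and decoding by `ofDigits2` cancel. Stopping is the only other difference
between the two executions, and `h0` excludes it before round `T`. -/
theorem run_stream (hid : Function.Injective ident) (ω : Coins V) (T : ℕ)
    (h0 : ∀ t < T, ∀ v, out (streamExec G ident P ini t v) = none) (t : ℕ) (ht : t ≤ T) (v : V) :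
    (streamAlg P ini out).run G ident ω t v =
      ⟨t, ident v, nbrIds G ident v, streamExec G ident P ini t v⟩ := by
  induction t generalizing v with
  | zero => simp [DistAlg.run, streamAlg, streamExec, nbrIds]
  | succ t ih =>
    have ih' : (streamAlg P ini out).run G ident ω t =
        fun v => ⟨t, ident v, nbrIds G ident v, streamExec G ident P ini t v⟩ :=
      funext fun v => ih (by omega) v
    have hv : (streamAlg P ini out).output ((streamAlg P ini out).run G ident ω t v) = none := by
      rw [ih (by omega) v]; exact h0 t (by omega) v
    refine (if_pos hv).trans ?_
    have hm : (fun u => (streamAlg P ini out).message G ident ω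
        ((streamAlg P ini out).run G ident ω t) t u v) = fun u =>
        (outgoing G ident (P t) (streamExec G ident P ini t) u v).map Nat.bits := by
      rw [ih']
      exact funext fun u => message_stream G P ini out ω
        (fun v => ⟨t, ident v, nbrIds G ident v, streamExec G ident P ini t v⟩) t
        (fun v => ⟨rfl, rfl, rfl⟩) (h0 t (by omega)) u v
    rw [hm, ih (by omega) v]
    simp only [streamAlg, streamExec_succ, Step.app, extend_map hid, Option.map_map]
    have : ofDigits2 ∘ Nat.bits = id := funext ofDigits2_bits
    simp only [this, Option.map_id, id]
    rfl

/-- All vertices stop in the same round `T`, so no vertex ever runs beside a stopped one and the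
execution simply freezes. -/
theorem run_stream_of_le (hid : Function.Injective ident) (ω : Coins V) (T : ℕ)
    (h0 : ∀ t < T, ∀ v, out (streamExec G ident P ini t v) = none)
    (h1 : ∀ v, out (streamExec G ident P ini T v) ≠ none) (t : ℕ) (ht : T ≤ t) (v : V) :
    (streamAlg P ini out).run G ident ω t v =
      ⟨T, ident v, nbrIds G ident v, streamExec G ident P ini T v⟩ := by
  induction t, ht using Nat.le_induction generalizing v with
  | base => exact run_stream G P ini out hid ω T h0 T le_rfl v
  | succ t ht ih =>
    refine (if_neg ?_).trans (ih v)
    rw [ih v]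
    exact h1 v

theorem sent_stream (hid : Function.Injective ident) (ω : Coins V) (T : ℕ)
    (h0 : ∀ t < T, ∀ v, out (streamExec G ident P ini t v) = none)
    (h1 : ∀ v, out (streamExec G ident P ini T v) ≠ none) (t : ℕ) (u v : V) :
    (streamAlg P ini out).sent G ident ω t u v = if t < T then
      (outgoing G ident (P t) (streamExec G ident P ini t) u v).map Nat.bits else none := by
  split_ifs with h
  · have : (streamAlg P ini out).run G ident ω t =
        fun v => ⟨t, ident v, nbrIds G ident v, streamExec G ident P ini t v⟩ :=
      funext fun v => run_stream G P ini out hid ω T h0 t h.le v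
    rw [DistAlg.sent, this]
    exact message_stream G P ini out ω
      (fun v => ⟨t, ident v, nbrIds G ident v, streamExec G ident P ini t v⟩) t (fun v => ⟨rfl, rfl, rfl⟩) (h0 t h) u v
  · rw [DistAlg.sent, DistAlg.message, if_neg]
    rintro ⟨-, h2⟩
    rw [run_stream_of_le G P ini out hid ω T h0 h1 t (by omega)] at h2
    exact h1 u h2

theorem length_msgs_stream (T : ℕ) (u v : V) :
    (msgs G ident ((List.range T).map P) (fun v => ini (nbrIds G ident v)) u v).length =
      ∑ t ∈ Finset.range T,
        (outgoing G ident (P t) (streamExec G ident P ini t) u v).toList.length := by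
  induction T with
  | zero => simp
  | succ T ih =>
    rw [Finset.sum_range_succ, List.range_succ, List.map_append, msgs_append, List.length_append, ih]
    simp [streamExec]

theorem mem_msgs_stream (T : ℕ) (u v : V) (x t : ℕ) (ht : t < T)
    (hx : outgoing G ident (P t) (streamExec G ident P ini t) u v = some x) :
    x ∈ msgs G ident ((List.range T).map P) (fun v => ini (nbrIds G ident v)) u v := by
  induction T with
  | zero => omega
  | succ T ih =>
    rw [List.range_succ, List.map_append, msgs_append, List.mem_append]
    rcases Nat.lt_succ_iff_lt_or_eq.1 ht with h | rfl
    · exact Or.inl (ih h)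
    · right
      simp only [List.map_cons, List.map_nil, msgs_cons, msgs_nil, List.append_nil]
      rw [← streamExec, hx]
      simp

theorem traffic_stream_le (hid : Function.Injective ident) (ω : Coins V) (T : ℕ)
    (h0 : ∀ t < T, ∀ v, out (streamExec G ident P ini t v) = none)
    (h1 : ∀ v, out (streamExec G ident P ini T v) ≠ none) (T' : ℕ) (u v : V) :
    (streamAlg P ini out).traffic G ident ω T' u v ≤
      (msgs G ident ((List.range T).map P) (fun v => ini (nbrIds G ident v)) u v).length +
      (msgs G ident ((List.range T).map P) (fun v => ini (nbrIds G ident v)) v u).length := by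
  rw [length_msgs_stream, length_msgs_stream, ← Finset.sum_add_distrib, DistAlg.traffic]
  have key : ∀ t u v, (if ((streamAlg P ini out).sent G ident ω t u v).isSome then 1 else 0) =
      if t < T then (outgoing G ident (P t) (streamExec G ident P ini t) u v).toList.length
        else 0 := by
    intro t u v
    rw [sent_stream G P ini out hid ω T h0 h1]
    by_cases h : t < T
    · simp only [h, if_true]
      cases outgoing G ident (P t) (streamExec G ident P ini t) u v <;> simp
    · simp [h]
  simp only [key]
  have key2 : ∀ t, (if t < T then
      (outgoing G ident (P t) (streamExec G ident P ini t) u v).toList.length else 0) +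
      (if t < T then (outgoing G ident (P t) (streamExec G ident P ini t) v u).toList.length
        else 0) = if t < T then
      (outgoing G ident (P t) (streamExec G ident P ini t) u v).toList.length +
      (outgoing G ident (P t) (streamExec G ident P ini t) v u).toList.length else 0 := by
    intro t; split_ifs <;> rfl
  simp only [key2]
  rw [← Finset.sum_filter]
  apply Finset.sum_le_sum_of_subset
  intro t
  simp

end Stream

/-! ### Registers and flooding waves -/

/-- Registers used by a wave: round of arrival, sender and value. -/
structure WaveReg where
  /-- the round in which the wave arrived (`0` for a source), if it did -/
  depth : Option ℕ
  /-- identifier of a neighbour from which the wave arrived -/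
  par : ℕ
  /-- the value carried by the wave -/
  val : ℕ

/-- The registers of a node. -/
structure Reg where
  /-- registers of the current wave -/
  wave : WaveReg
  /-- whether the node is still a candidate for the root -/
  alive : Prop
  /-- depth in the agreed breadth-first tree, if there is one -/
  dep : Option ℕ
  /-- identifier of the parent in the tree -/
  par : ℕ
  /-- size of the own subtree -/
  sz : ℕ
  /-- sizes of the subtrees of the children, by identifier -/
  csz : ℕ → Option ℕ
  /-- preorder label -/
  lab : ℕ
  /-- least label seen from the own subtree -/
  lo : ℕ
  /-- greatest label seen from the own subtree -/
  hi : ℕ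
  /-- discovered links between child subtrees (`none` is the part outside the own subtree) -/
  link : Option ℕ → Option ℕ → Prop
  /-- output -/
  out : Option Bool

section Network

variable {V : Type} [Fintype V] (G : SimpleGraph V) (ident : V → ℕ)

/-- In the execution of `l` from `s`, at most `N` messages are sent through each edge in each
direction, and all of them satisfy `Q`. -/
def MsgBound {R : Type} (l : List (Step R)) (s : V → R) (N : ℕ) (Q : ℕ → Prop) : Prop :=
  ∀ u v, (msgs G ident l s u v).length ≤ N ∧ ∀ m ∈ msgs G ident l s u v, Q m

variable {G ident}

theorem MsgBound.append {R : Type} {l₁ l₂ : List (Step R)} {s : V → R} {N₁ N₂ : ℕ} {Q : ℕ → Prop}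
    (h₁ : MsgBound G ident l₁ s N₁ Q) (h₂ : MsgBound G ident l₂ (exec G ident l₁ s) N₂ Q) :
    MsgBound G ident (l₁ ++ l₂) s (N₁ + N₂) Q := by
  intro u v
  rw [msgs_append, List.length_append]
  refine ⟨Nat.add_le_add (h₁ u v).1 (h₂ u v).1, fun m hm => ?_⟩
  rcases List.mem_append.1 hm with h | h
  · exact (h₁ u v).2 m h
  · exact (h₂ u v).2 m h

theorem MsgBound.mono {R : Type} {l : List (Step R)} {s : V → R} {N N' : ℕ} {Q Q' : ℕ → Prop}
    (h : MsgBound G ident l s N Q) (hN : N ≤ N') (hQ : ∀ m, Q m → Q' m) :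
    MsgBound G ident l s N' Q' :=
  fun u v => ⟨(h u v).1.trans hN, fun m hm => hQ m ((h u v).2 m hm)⟩

theorem MsgBound.nil {R : Type} {s : V → R} {Q : ℕ → Prop} :
    MsgBound G ident [] s 0 Q := fun u v => by simp

theorem msgBound_silent {R : Type} (st : Step R) (s : V → R)
    (h : ∀ u m, st.send (ident u) (nbrIds G ident u) (s u) m = none) (Q : ℕ → Prop) :
    MsgBound G ident [st] s 0 Q := by
  intro u v
  simp [outgoing, h]

theorem msgBound_single {R : Type} (st : Step R) (s : V → R) (Q : ℕ → Prop)
    (h : ∀ u m x, st.send (ident u) (nbrIds G ident u) (s u) m = some x → Q x) :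
    MsgBound G ident [st] s 1 Q := by
  intro u v
  simp only [msgs_cons, msgs_nil, List.append_nil, outgoing]
  split_ifs with hA
  · cases hx : st.send (ident u) (nbrIds G ident u) (s u) (ident v) with
    | none => simp
    | some x => simpa using h u _ x hx
  · simp

end Network

open Classical in
/-- A round of a wave: nodes reached in the previous round forward the value. -/
noncomputable def waveStep (k : ℕ) : Step Reg where
  send _ _ s _ := if s.wave.depth = some k then some s.wave.val else none
  recv _ _ s I :=
    -- Several copies of the wave may arrive in the same round. An arbitrary one is kept: any sender
    -- is a valid breadth-first parent, and conflicting values are caught later by comparison.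
    if h : s.wave.depth = none ∧ ∃ p : ℕ × ℕ, I p.1 = some p.2 then
      { s with wave := ⟨some (k + 1), h.2.choose.1, h.2.choose.2⟩ }
    else s

/-- A wave of `k` rounds. -/
noncomputable def waves (k : ℕ) : List (Step Reg) := (List.range k).map waveStep

section Network

variable {V : Type} [Fintype V] (G : SimpleGraph V) {ident : V → ℕ}

/-- The registers after a wave of `k` rounds from the sources in `s`. -/
structure WaveInv (ident : V → ℕ) (k : ℕ) (s s' : V → Reg) : Prop where
  frame : ∀ v, s' v = { s v with wave := (s' v).wave }
  le : ∀ v h, (s' v).wave.depth = some h → h ≤ k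
  source : ∀ v, (s v).wave.depth = some 0 → (s' v).wave = (s v).wave
  zero : ∀ v, (s' v).wave.depth = some 0 → (s v).wave.depth = some 0
  succ : ∀ v h, (s' v).wave.depth = some (h + 1) → ∃ u, G.Adj u v ∧ (s' v).wave.par = ident u ∧
    (s' u).wave.depth = some h ∧ (s' u).wave.val = (s' v).wave.val
  adj : ∀ u v h, G.Adj u v → (s' u).wave.depth = some h → h < k →
    ∃ h' ≤ h + 1, (s' v).wave.depth = some h'

/-- Once set, the wave register of a node never changes again (`hold`), so only nodes first reached
in the last round need an argument. -/
theorem waves_inv (hid : Function.Injective ident) (s : V → Reg)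
    (h0 : ∀ v, (s v).wave.depth = none ∨ (s v).wave.depth = some 0) (k : ℕ) :
    WaveInv G ident k s (exec G ident (waves k) s) := by
  induction k with
  | zero =>
    refine ⟨fun v => rfl, ?_, fun v _ => rfl, fun v h => h, ?_, fun u v h _ _ h' => by omega⟩
    · intro v h hv
      rcases h0 v with h' | h' <;> simp_all [waves]
    · intro v h hv
      rcases h0 v with h' | h' <;> simp_all [waves]
  | succ k ih =>
    have hs : exec G ident (waves (k + 1)) s =
        (waveStep k).app G ident (exec G ident (waves k) s) := by
      simp [waves, List.range_succ, exec_append]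
    rw [hs]
    set s' := exec G ident (waves k) s with hs'
    set s'' := (waveStep k).app G ident s' with hs''
    have hnew : ∀ v, (s'' v = s' v ∧ ((s' v).wave.depth = none →
        ∀ u, G.Adj u v → (s' u).wave.depth ≠ some k)) ∨ ((s' v).wave.depth = none ∧
        ∃ u, G.Adj u v ∧ (s' u).wave.depth = some k ∧
          s'' v = { s' v with wave := ⟨some (k + 1), ident u, (s' u).wave.val⟩ }) := by
      intro v
      by_cases h : (s' v).wave.depth = none ∧
          ∃ p : ℕ × ℕ, inbox G ident (waveStep k) s' v p.1 = some p.2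
      · right
        refine ⟨h.1, ?_⟩
        have hc := h.2.choose_spec
        rw [inbox_eq_some G hid] at hc
        obtain ⟨u, hu, hA, hx⟩ := hc
        simp only [waveStep] at hx
        split_ifs at hx with hd
        refine ⟨u, hA, hd, ?_⟩
        refine (dif_pos h).trans ?_
        rw [hu, Option.some.inj hx]
        rfl
      · left
        refine ⟨?_, fun hn u hA hd => h ⟨hn, ⟨ident u, (s' u).wave.val⟩, ?_⟩⟩
        · exact dif_neg h
        · rw [inbox_eq_some G hid]
          exact ⟨u, rfl, hA, by simp [waveStep, hd]⟩
    have hold : ∀ v h, (s' v).wave.depth = some h → s'' v = s' v := by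
      intro v h hv
      rcases hnew v with h' | h'
      · exact h'.1
      · rw [h'.1] at hv; cases hv
    constructor
    · intro v
      rcases hnew v with h | ⟨-, u, -, -, h⟩
      · rw [h.1]; exact ih.frame v
      · rw [h]
        conv_lhs => rw [ih.frame v]
    · intro v h hv
      rcases hnew v with h' | ⟨-, u, -, -, h'⟩
      · rw [h'.1] at hv
        exact (ih.le v h hv).trans (by omega)
      · rw [h'] at hv
        simp only [Option.some.injEq] at hv
        omega
    · intro v hv
      have := ih.source v hv
      rw [hold v 0 (by rw [this, hv]), this]
    · intro v hv
      rcases hnew v with h' | ⟨-, u, -, -, h'⟩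
      · rw [h'.1] at hv
        exact ih.zero v hv
      · rw [h'] at hv
        simp at hv
    · intro v h hv
      rcases hnew v with h' | ⟨-, u, hA, hd, h'⟩
      · rw [h'.1] at hv
        obtain ⟨u, h1, h2, h3, h4⟩ := ih.succ v h hv
        refine ⟨u, h1, ?_⟩
        rw [h'.1, hold u h h3]
        exact ⟨h2, h3, h4⟩
      · refine ⟨u, hA, ?_⟩
        rw [h'] at hv
        simp only [Option.some.injEq, Nat.add_right_cancel_iff] at hv
        subst hv
        rw [h', hold u _ hd]
        exact ⟨rfl, hd, rfl⟩
    · intro u v h hA hu hk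
      rcases hnew u with h' | ⟨-, w, -, -, h'⟩
      · rw [h'.1] at hu
        by_cases hv : (s' v).wave.depth = none
        · rcases hnew v with h'' | ⟨-, w, -, -, h''⟩
          · have := h''.2 hv u hA
            have hne : h ≠ k := by rintro rfl; exact this hu
            rw [h''.1]
            exact ih.adj u v h hA hu (by omega)
          · by_cases hh : h < k
            · obtain ⟨j, -, hj⟩ := ih.adj u v h hA hu hh
              rw [hv] at hj; cases hj
            · refine ⟨k + 1, by omega, ?_⟩
              rw [h'']
        · obtain ⟨j, hj⟩ := Option.ne_none_iff_exists'.1 hv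
          rw [hold v j hj]
          by_cases hh : h < k
          · exact ih.adj u v h hA hu hh
          · exact ⟨j, (ih.le v j hj).trans (by omega), hj⟩
      · rw [h'] at hu
        simp only [Option.some.injEq] at hu
        omega

end Network

section Wave

variable {V : Type} {G : SimpleGraph V} {ident : V → ℕ}

theorem WaveInv.walk {k : ℕ} {s s' : V → Reg} (W : WaveInv G ident k s s') {u v : V}
    (p : G.Walk v u) (hu : (s u).wave.depth = some 0) (hp : p.length ≤ k) :
    ∃ h ≤ p.length, (s' v).wave.depth = some h := by
  induction p with
  | nil => exact ⟨0, le_rfl, by rw [W.source _ hu, hu]⟩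
  | cons hA q ih =>
    rw [SimpleGraph.Walk.length_cons] at hp ⊢
    obtain ⟨h, h1, h2⟩ := ih hu (by omega)
    obtain ⟨h', h3, h4⟩ := W.adj _ _ h hA.symm h2 (by omega)
    exact ⟨h', by omega, h4⟩

theorem WaveInv.exists_source {k : ℕ} {s s' : V → Reg} (W : WaveInv G ident k s s') {v : V} {h : ℕ}
    (hv : (s' v).wave.depth = some h) : ∃ u, (s u).wave.depth = some 0 ∧
      (s u).wave.val = (s' v).wave.val ∧ ∃ p : G.Walk v u, p.length = h := by
  induction h generalizing v with
  | zero =>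
    have := W.zero v hv
    exact ⟨v, this, by rw [W.source v this], .nil, rfl⟩
  | succ h ih =>
    obtain ⟨w, h1, -, h3, h4⟩ := W.succ v h hv
    obtain ⟨u, h5, h6, p, h7⟩ := ih h3
    exact ⟨u, h5, h6.trans h4, .cons h1.symm p, by simp [h7]⟩

end Wave

section Network

variable {V : Type} [Fintype V] (G : SimpleGraph V) {ident : V → ℕ}

/-- A node speaks only in the round whose number is its own arrival depth, and this depth is never
overwritten. Hence a wave costs one message per edge and direction, however many sources it has. -/
theorem waves_msgs (s : V → Reg) (k : ℕ) (u v : V) :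
    msgs G ident (waves k) s u v = [] ∨
      msgs G ident (waves k) s u v = [(exec G ident (waves k) s u).wave.val] ∧
      ∃ h < k, (exec G ident (waves k) s u).wave.depth = some h := by
  induction k with
  | zero => exact Or.inl rfl
  | succ k ih =>
    have hs : exec G ident (waves (k + 1)) s =
        (waveStep k).app G ident (exec G ident (waves k) s) := by
      simp [waves, List.range_succ, exec_append]
    have hm : msgs G ident (waves (k + 1)) s u v = msgs G ident (waves k) s u v ++
        (outgoing G ident (waveStep k) (exec G ident (waves k) s) u v).toList := by
      simp [waves, List.range_succ, msgs_append]
    have hold : ∀ h, (exec G ident (waves k) s u).wave.depth = some h →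
        exec G ident (waves (k + 1)) s u = exec G ident (waves k) s u := by
      intro h hu
      rw [hs, Step.app]
      simp [waveStep, hu]
    rw [hm]
    by_cases hd : (exec G ident (waves k) s u).wave.depth = some k
    · have h1 : msgs G ident (waves k) s u v = [] := by
        rcases ih with h | ⟨-, h, hk, hh⟩
        · exact h
        · rw [hd] at hh
          simp only [Option.some.injEq] at hh
          omega
      rw [h1, hold k hd]
      by_cases hA : G.Adj u v
      · right
        exact ⟨by simp [outgoing, hA, waveStep, hd], k, by omega, hd⟩
      · left; simp [outgoing, hA]
    · have : outgoing G ident (waveStep k) (exec G ident (waves k) s) u v = none := by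
        simp [outgoing, waveStep, hd]
      rw [this]
      rcases ih with h | ⟨h1, h, hk, hh⟩
      · left; simp [h]
      · right
        rw [hold h hh]
        exact ⟨by simp [h1], h, by omega, hh⟩

theorem waves_msgBound (hid : Function.Injective ident) (s : V → Reg)
    (h0 : ∀ v, (s v).wave.depth = none ∨ (s v).wave.depth = some 0) (k : ℕ) (Q : ℕ → Prop)
    (hQ : ∀ v, (s v).wave.depth = some 0 → Q (s v).wave.val) :
    MsgBound G ident (waves k) s 1 Q := by
  intro u v
  rcases waves_msgs G (ident := ident) s k u v with h | ⟨h, j, -, hj⟩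
  · simp [h]
  · rw [h]
    refine ⟨le_rfl, fun m hm => ?_⟩
    obtain ⟨w, h1, h2, -⟩ := (waves_inv G hid s h0 k).exists_source hj
    rw [List.mem_singleton.1 hm, ← h2]
    exact hQ w h1

theorem waves_msgBound_zero (hid : Function.Injective ident) (s : V → Reg)
    (h0 : ∀ v, (s v).wave.depth = none) (k : ℕ) (Q : ℕ → Prop) :
    MsgBound G ident (waves k) s 0 Q := by
  intro u v
  rcases waves_msgs G (ident := ident) s k u v with h | ⟨h, j, -, hj⟩
  · simp [h]
  · obtain ⟨w, h1, -⟩ := (waves_inv G hid s (fun v => Or.inl (h0 v)) k).exists_source hj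
    rw [h0 w] at h1
    cases h1

end Network

/-! ### Leader election and verified breadth-first tree -/

/-- A round that only updates registers. -/
def localStep (f : ℕ → Finset ℕ → Reg → Reg) : Step Reg where
  send _ _ _ _ := none
  recv i N s _ := f i N s

open Classical in
/-- Election between the candidates with bit `i` set and those without. -/
noncomputable def electBit (d i : ℕ) : List (Step Reg) :=
  localStep (fun j _ s =>
      { s with wave := ⟨if s.alive ∧ j.testBit i then some 0 else none, 0, 0⟩ }) :: waves d ++
    [localStep fun j _ s => { s with alive := s.alive ∧ (j.testBit i ∨ s.wave.depth = none) }]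

/-- Election on the lowest `L` bits of the identifiers with waves of `d` rounds. -/
noncomputable def elect (d L : ℕ) : List (Step Reg) :=
  localStep (fun _ _ s => { s with alive := True }) :: (List.range L).flatMap (electBit d)

open Classical in
/-- Neighbours compare the values carried by the wave; the nodes that notice that the wave did not
build a spanning tree become sources of the next wave. -/
noncomputable def compareStep (L : ℕ) : Step Reg where
  send _ _ s _ := s.wave.depth.map fun _ => s.wave.val
  recv i N s I := { s with
    dep := s.wave.depth
    par := s.wave.par
    -- Alarm if the node was not reached, if its identifier is too long, or if some neighbour was
    -- not reached or holds another value. The length test guarantees `n ≤ 2 ^ L`, which makes `L`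
    -- phases enough.
    wave := ⟨if s.wave.depth = none ∨ L < i.size ∨ ∃ m ∈ N, I m ≠ some s.wave.val then some 0
      else none, 0, 0⟩ }

open Classical in
/-- Leader election and construction of a breadth-first tree of depth at most `d`. The register
`dep` is `none` if this failed. -/
noncomputable def setup (d L : ℕ) : List (Step Reg) :=
  elect d L ++ (localStep (fun j _ s =>
    { s with wave := ⟨if s.alive then some 0 else none, 0, j⟩ }) :: waves d ++
  (compareStep L :: waves (2 * d) ++
  [localStep fun _ _ s => { s with dep := if s.wave.depth = none then s.dep else none }]))

section Network

variable {V : Type} [Fintype V] (G : SimpleGraph V) {ident : V → ℕ}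

theorem localStep_app (f : ℕ → Finset ℕ → Reg → Reg) (s : V → Reg) :
    (localStep f).app G ident s = fun v => f (ident v) (nbrIds G ident v) (s v) := rfl

theorem localStep_msgBound (f : ℕ → Finset ℕ → Reg → Reg) (s : V → Reg) (Q : ℕ → Prop) :
    MsgBound G ident [localStep f] s 0 Q := msgBound_silent _ _ (fun _ _ => rfl) Q

theorem electBit_alive (hid : Function.Injective ident) (d i : ℕ)
    (hd : ∀ u v, ∃ p : G.Walk u v, p.length ≤ d) (s : V → Reg) (v : V) :
    (exec G ident (electBit d i) s v).alive ↔ (s v).alive ∧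
      ((ident v).testBit i ∨ ¬ ∃ u, (s u).alive ∧ (ident u).testBit i) := by
  classical
  simp only [electBit, List.cons_append, exec_cons, exec_append, localStep_app, exec_nil]
  set s₁ : V → Reg := fun v =>
    { s v with wave := ⟨if (s v).alive ∧ (ident v).testBit i then some 0 else none, 0, 0⟩ }
    with hs₁
  have h0 : ∀ v, (s₁ v).wave.depth = none ∨ (s₁ v).wave.depth = some 0 := by
    intro v; simp only [hs₁]; split_ifs <;> simp
  have h1 : ∀ v, (s₁ v).wave.depth = some 0 ↔ (s v).alive ∧ (ident v).testBit i := by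
    intro v; simp only [hs₁]; split_ifs with h <;> simp [h]
  have W := waves_inv G hid s₁ h0 d
  have hal : (exec G ident (waves d) s₁ v).alive = (s v).alive := by rw [W.frame v]
  rw [hal]
  refine and_congr_right fun _ => or_congr_right ?_
  constructor
  · rintro hn ⟨u, hu⟩
    obtain ⟨p, hp⟩ := hd v u
    obtain ⟨h, -, hh⟩ := W.walk p ((h1 u).2 hu) hp
    rw [hn] at hh; cases hh
  · intro hn
    by_contra hne
    obtain ⟨h, hh⟩ := Option.ne_none_iff_exists'.1 hne
    obtain ⟨u, hu, -⟩ := W.exists_source hh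
    exact hn ⟨u, (h1 u).1 hu⟩

/-- For each bit, if some candidate has it set, every candidate hears so and those without it
withdraw; otherwise nobody does. Either way some candidate survives and all survivors agree on the
bit. -/
theorem elect_alive (hid : Function.Injective ident) (d L : ℕ) [Nonempty V]
    (hd : ∀ u v, ∃ p : G.Walk u v, p.length ≤ d) (s : V → Reg) :
    (∃ v, (exec G ident (elect d L) s v).alive) ∧
    ∀ u v, (exec G ident (elect d L) s u).alive → (exec G ident (elect d L) s v).alive →
      ∀ i < L, (ident u).testBit i = (ident v).testBit i := by
  simp only [elect, exec_cons, localStep_app]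
  induction L with
  | zero =>
    simp
  | succ L ih =>
    obtain ⟨⟨w, hw⟩, ih⟩ := ih
    rw [List.range_succ, List.flatMap_append, exec_append]
    simp only [List.flatMap_cons, List.flatMap_nil, List.append_nil]
    simp only [electBit_alive G hid d L hd]
    set s' := exec G ident ((List.range L).flatMap (electBit d)) (fun v => { s v with alive := True })
    constructor
    · by_cases h : ∃ u, (s' u).alive ∧ (ident u).testBit L
      · obtain ⟨u, hu⟩ := h
        exact ⟨u, hu.1, Or.inl hu.2⟩
      · exact ⟨w, hw, Or.inr h⟩
    · rintro u v ⟨hu, hu'⟩ ⟨hv, hv'⟩ i hi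
      rcases Nat.lt_succ_iff_lt_or_eq.1 hi with h | rfl
      · exact ih u v hu hv i h
      · rcases hu' with hu' | hu' <;> rcases hv' with hv' | hv'
        · rw [hu', hv']
        · exact absurd ⟨u, hu, hu'⟩ hv'
        · exact absurd ⟨v, hv, hv'⟩ hu'
        · have h1 : (ident u).testBit i ≠ true := fun h => hu' ⟨u, hu, h⟩
          have h2 : (ident v).testBit i ≠ true := fun h => hu' ⟨v, hv, h⟩
          simp only [ne_eq, Bool.not_eq_true] at h1 h2
          rw [h1, h2]

/-- On bits `i ≥ S` no candidate is a source, so nothing is sent. This keeps the cost of the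
election independent of the guess `L`. -/
theorem electBit_msgBound (hid : Function.Injective ident) (d i S : ℕ)
    (hS : ∀ v, (ident v).size ≤ S) (s : V → Reg) :
    MsgBound G ident (electBit d i) s (if i < S then 1 else 0) (fun m => m = 0) := by
  classical
  have h0 : ∀ v, ((localStep (fun j _ s =>
      { s with wave := ⟨if s.alive ∧ j.testBit i then some 0 else none, 0, 0⟩ })).app
        G ident s v).wave.depth = none ∨ ((localStep (fun j _ s =>
      { s with wave := ⟨if s.alive ∧ j.testBit i then some 0 else none, 0, 0⟩ })).app
        G ident s v).wave.depth = some 0 := by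
    intro v; simp only [localStep_app]; split_ifs <;> simp
  have h2 : MsgBound G ident (waves d) ((localStep (fun j _ s =>
      { s with wave := ⟨if s.alive ∧ j.testBit i then some 0 else none, 0, 0⟩ })).app G ident s)
      (if i < S then 1 else 0) (fun m => m = 0) := by
    split_ifs with hi
    · exact waves_msgBound G hid _ h0 d _ fun v _ => rfl
    · refine waves_msgBound_zero G hid _ (fun v => ?_) d _
      have : (ident v).testBit i = false :=
        Nat.testBit_eq_false_of_lt (Nat.size_le.1 ((hS v).trans (not_lt.1 hi)))
      simp [localStep_app, this]
  have := ((localStep_msgBound G _ s _).append h2).append (localStep_msgBound G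
    (fun j _ s => { s with alive := s.alive ∧ (j.testBit i ∨ s.wave.depth = none) }) _ _)
  exact this.mono (by simp) fun _ h => h

theorem elect_msgBound (hid : Function.Injective ident) (d L S : ℕ)
    (hS : ∀ v, (ident v).size ≤ S) (s : V → Reg) :
    MsgBound G ident (elect d L) s S (fun m => m = 0) := by
  suffices h : ∀ s, MsgBound G ident ((List.range L).flatMap (electBit d)) s (min L S)
      (fun m => m = 0) by
    exact ((localStep_msgBound G _ s _).append (h _)).mono (by simp) fun _ h => h
  intro s
  induction L with
  | zero => simpa using MsgBound.nil
  | succ L ih =>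
    rw [List.range_succ, List.flatMap_append]
    refine (ih.append (N₂ := if L < S then 1 else 0) ?_).mono ?_ fun _ h => h
    · simpa using electBit_msgBound G hid d L S hS _
    · split_ifs <;> omega

end Network

/-- The registers `dep` and `par` describe a breadth-first tree with root `r` and parents `q`. -/
structure IsTree {V : Type} (G : SimpleGraph V) (ident : V → ℕ) (r : V) (q : V → V)
    (s : V → Reg) : Prop where
  dep : ∀ v, (s v).dep = some (G.dist r v)
  adj : ∀ v, v ≠ r → G.Adj (q v) v
  dist : ∀ v, v ≠ r → G.dist r v = G.dist r (q v) + 1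
  par : ∀ v, v ≠ r → (s v).par = ident (q v)

section Tree

variable {V : Type} (G : SimpleGraph V) {ident : V → ℕ}

theorem exists_walk_le {d : ℕ} (hG : G.Connected) (u v : V) (h : G.dist u v ≤ d) :
    ∃ p : G.Walk u v, p.length ≤ d := by
  obtain ⟨p, hp⟩ := hG.exists_walk_length_eq_dist u v
  exact ⟨p, by omega⟩

/-- A wave that carries the same identifier to all vertices has built a breadth-first tree. -/
theorem isTree_of_wave (hid : Function.Injective ident) (hG : G.Connected) {d : ℕ}
    {s s' : V → Reg} (W : WaveInv G ident d s s')
    (hs : ∀ v, (s v).wave.val = ident v) (hre : ∀ v, (s' v).wave.depth ≠ none)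
    (hval : ∀ u v, G.Adj u v → (s' u).wave.val = (s' v).wave.val) {t : V → Reg}
    (ht : ∀ v, (t v).dep = (s' v).wave.depth ∧ (t v).par = (s' v).wave.par) :
    ∃ r q, IsTree G ident r q t ∧ ∀ v, G.dist r v ≤ d := by
  have hval' : ∀ u v, (s' u).wave.val = (s' v).wave.val := by
    intro u v
    obtain ⟨p⟩ := hG.preconnected u v
    induction p with
    | nil => rfl
    | cons hA _ ih => exact (hval _ _ hA).trans ih
  obtain ⟨v₀⟩ := hG.nonempty
  obtain ⟨h₀, hh₀⟩ := Option.ne_none_iff_exists'.1 (hre v₀)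
  obtain ⟨r, hr, hr', -⟩ := W.exists_source hh₀
  -- Sources carry their own identifiers and all values agree, so every node was reached from the
  -- single source `r`.
  have hsrc : ∀ v h, (s' v).wave.depth = some h → ∃ p : G.Walk v r, p.length = h := by
    intro v h hv
    obtain ⟨u, -, h2, p, hp⟩ := W.exists_source hv
    have : u = r := hid (by rw [← hs u, ← hs r, h2, hr', hval' v v₀])
    subst this
    exact ⟨p, hp⟩
  -- The arrival depth is the length of some walk to `r`, hence at least the distance. The distance
  -- is then at most `d`, so a shortest walk bounds the depth from above.
  have hdep : ∀ v, (s' v).wave.depth = some (G.dist r v) := by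
    intro v
    obtain ⟨h, hv⟩ := Option.ne_none_iff_exists'.1 (hre v)
    obtain ⟨p, hp⟩ := hsrc v h hv
    have h1 : G.dist v r ≤ h := hp ▸ SimpleGraph.dist_le p
    obtain ⟨p', hp'⟩ := hG.exists_walk_length_eq_dist v r
    obtain ⟨h', h2, h3⟩ := W.walk p' hr (by have := W.le v h hv; omega)
    rw [hv] at h3
    rw [hv, SimpleGraph.dist_comm]
    simp only [Option.some.injEq] at h3 ⊢
    omega
  have hq : ∀ v, ∃ u, v ≠ r → G.Adj u v ∧ (s' v).wave.par = ident u ∧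
      (G.dist r v = G.dist r u + 1) := by
    intro v
    by_cases hv : v = r
    · exact ⟨v, fun h => absurd hv h⟩
    · have : 0 < G.dist r v := hG.pos_dist_of_ne (Ne.symm hv)
      obtain ⟨h, hh⟩ : ∃ h, G.dist r v = h + 1 := ⟨G.dist r v - 1, by omega⟩
      obtain ⟨u, h1, h2, h3, -⟩ := W.succ v h (by rw [hdep v, hh])
      rw [hdep u] at h3
      simp only [Option.some.injEq] at h3
      exact ⟨u, fun _ => ⟨h1, h2, by omega⟩⟩
  choose q hq using hq
  refine ⟨r, q, ⟨fun v => by rw [(ht v).1, hdep], fun v hv => (hq v hv).1,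
    fun v hv => (hq v hv).2.2, fun v hv => by rw [(ht v).2, (hq v hv).2.1]⟩, fun v => ?_⟩
  exact W.le v _ (hdep v)

end Tree

section Network

variable {V : Type} [Fintype V] (G : SimpleGraph V) {ident : V → ℕ}

-- The alarm makes the outcome unanimous. Without an alarm the wave has a single source and has
-- built a breadth-first tree. With an alarm anywhere, `2 * d` rounds carry some alarm to every
-- vertex. If `d` and `L` are large enough, the election leaves one candidate, whose wave reaches
-- all vertices, and no alarm arises.
open Classical in
theorem setup_spec (hid : Function.Injective ident) (hG : G.Connected) (d L : ℕ)
    (s : V → Reg) :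
    ((∀ v, (exec G ident (setup d L) s v).dep = none) ∧
      ¬ (G.diam ≤ d ∧ ∀ v, (ident v).size ≤ L)) ∨
    ((∀ v, (ident v).size ≤ L) ∧
      ∃ r q, IsTree G ident r q (exec G ident (setup d L) s) ∧ ∀ v, G.dist r v ≤ d) := by
  have hne := hG.nonempty
  simp only [setup, List.cons_append, exec_cons, exec_append, localStep_app, exec_nil]
  set s₁ := exec G ident (elect d L) s with hs₁
  set s₂ : V → Reg := fun v =>
    { s₁ v with wave := ⟨if (s₁ v).alive then some 0 else none, 0, ident v⟩ } with hs₂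
  have h2 : ∀ v, (s₂ v).wave.depth = none ∨ (s₂ v).wave.depth = some 0 := by
    intro v; simp only [hs₂]; split_ifs <;> simp
  have h2' : ∀ v, (s₂ v).wave.depth = some 0 ↔ (s₁ v).alive := by
    intro v; simp only [hs₂]; split_ifs with h <;> simp [h]
  set s₃ := exec G ident (waves d) s₂ with hs₃
  have W := waves_inv G hid s₂ h2 d
  rw [← hs₃] at W
  set s₄ := (compareStep L).app G ident s₃ with hs₄
  have h4dep : ∀ v, (s₄ v).dep = (s₃ v).wave.depth ∧ (s₄ v).par = (s₃ v).wave.par :=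
    fun v => ⟨rfl, rfl⟩
  have h4 : ∀ v, (s₄ v).wave.depth = none ∨ (s₄ v).wave.depth = some 0 := by
    intro v
    simp only [hs₄, Step.app, compareStep]
    split_ifs <;> simp
  have h4' : ∀ v, (s₄ v).wave.depth = none ↔ (s₃ v).wave.depth ≠ none ∧ (ident v).size ≤ L ∧
      ∀ u, G.Adj u v → (s₃ u).wave.depth ≠ none ∧ (s₃ u).wave.val = (s₃ v).wave.val := by
    intro v
    have hI : (∃ m ∈ nbrIds G ident v, inbox G ident (compareStep L) s₃ v m ≠
        some (s₃ v).wave.val) ↔ ¬ ∀ u, G.Adj u v → (s₃ u).wave.depth ≠ none ∧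
          (s₃ u).wave.val = (s₃ v).wave.val := by
      have hmsg : ∀ u, G.Adj u v → (inbox G ident (compareStep L) s₃ v (ident u) =
          some (s₃ v).wave.val ↔ (s₃ u).wave.depth ≠ none ∧
          (s₃ u).wave.val = (s₃ v).wave.val) := by
        intro u hA
        rw [inbox_ident G hid, outgoing, if_pos hA]
        simp only [compareStep]
        cases (s₃ u).wave.depth <;> simp
      push Not
      constructor
      · rintro ⟨m, hm, hne⟩
        obtain ⟨u, hu, rfl⟩ : ∃ u, G.Adj v u ∧ ident u = m := by simpa [nbrIds] using hm
        refine ⟨u, hu.symm, fun h1 h2 => hne ((hmsg u hu.symm).2 ⟨h1, h2⟩)⟩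
      · rintro ⟨u, hA, h⟩
        refine ⟨ident u, (mem_nbrIds G hid u v).2 hA.symm, fun h' => ?_⟩
        have := (hmsg u hA).1 h'
        exact h this.1 this.2
    have : (s₄ v).wave.depth = if (s₃ v).wave.depth = none ∨ L < (ident v).size ∨
        ∃ m ∈ nbrIds G ident v, inbox G ident (compareStep L) s₃ v m ≠ some (s₃ v).wave.val
        then some 0 else none := rfl
    rw [this]
    split_ifs with h <;> rw [hI] at h
    · simp only [false_iff]
      rintro ⟨h1, h2, h3⟩
      rcases h with h | h | h
      · exact h1 h
      · omega
      · exact h h3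
    · simp only [not_or, not_not, not_lt] at h
      simpa using h
  set s₅ := exec G ident (waves (2 * d)) s₄ with hs₅
  have W' := waves_inv G hid s₄ h4 (2 * d)
  rw [← hs₅] at W'
  have h5dep : ∀ v, (s₅ v).dep = (s₃ v).wave.depth ∧ (s₅ v).par = (s₃ v).wave.par := by
    intro v; rw [W'.frame v]; exact h4dep v
  by_cases hok : ∀ v, (s₄ v).wave.depth = none
  · right
    have h5 : ∀ v, (s₅ v).wave.depth = none := by
      intro v
      by_contra hne
      obtain ⟨h, hh⟩ := Option.ne_none_iff_exists'.1 hne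
      obtain ⟨u, hu, -⟩ := W'.exists_source hh
      rw [hok u] at hu; cases hu
    refine ⟨fun v => ((h4' v).1 (hok v)).2.1, ?_⟩
    refine isTree_of_wave G hid hG W (fun v => rfl) (fun v => ((h4' v).1 (hok v)).1)
      (fun u v hA => (((h4' v).1 (hok v)).2.2 u hA).2) fun v => ?_
    simp only [h5 v, if_true]
    exact h5dep v
  · left
    constructor
    · intro v
      suffices h : (s₅ v).wave.depth ≠ none by simp [h]
      -- Suppose no alarm starts within `2 * d` of `v`, and let `r` be the source of the value at
      -- `v`. Every vertex holding that value is within `d` of `r`, hence within `2 * d` of `v`, so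
      -- it raises no alarm and its neighbours hold the same value. By connectivity all vertices do,
      -- so there is no alarm at all, against `hok`.
      suffices h : ∃ u, (s₄ u).wave.depth = some 0 ∧ ∃ p : G.Walk v u, p.length ≤ 2 * d by
        obtain ⟨u, hu, p, hp⟩ := h
        obtain ⟨h, -, hh⟩ := W'.walk p hu hp
        rw [hh]; simp
      by_contra hcon
      have hcon : ∀ u (p : G.Walk v u), p.length ≤ 2 * d → (s₄ u).wave.depth = none := by
        intro u p hp
        rcases h4 u with h | h
        · exact h
        · exact absurd ⟨u, h, p, hp⟩ hcon
      have hv := (h4' v).1 (hcon v .nil (by simp))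
      obtain ⟨h, hh⟩ := Option.ne_none_iff_exists'.1 hv.1
      obtain ⟨r, hr, hr', p, hp⟩ := W.exists_source hh
      have hball : ∀ w, (s₃ w).wave.depth ≠ none → (s₃ w).wave.val = ident r →
          (s₄ w).wave.depth = none := by
        intro w hw hwv
        obtain ⟨j, hj⟩ := Option.ne_none_iff_exists'.1 hw
        obtain ⟨r', -, h2, p', hp'⟩ := W.exists_source hj
        have : r' = r := hid (h2.trans hwv)
        subst this
        refine hcon w (p.append p'.reverse) ?_
        rw [SimpleGraph.Walk.length_append, SimpleGraph.Walk.length_reverse, hp, hp']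
        have := W.le v h hh
        have := W.le w j hj
        omega
      have hall : ∀ w, (s₃ w).wave.depth ≠ none ∧ (s₃ w).wave.val = ident r := by
        have hwalk : ∀ a b, G.Walk a b →
            ((s₃ b).wave.depth ≠ none ∧ (s₃ b).wave.val = ident r) →
            (s₃ a).wave.depth ≠ none ∧ (s₃ a).wave.val = ident r := by
          intro a b p hb
          induction p with
          | nil => exact hb
          | cons hA p ih =>
            have ih := ih hb
            have := ((h4' _).1 (hball _ ih.1 ih.2)).2.2 _ hA
            exact ⟨this.1, this.2.trans ih.2⟩
        intro w
        obtain ⟨p⟩ := hG.preconnected w v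
        exact hwalk w v p ⟨hv.1, hr'.symm⟩
      exact hok fun w => hball w (hall w).1 (hall w).2
    · rintro ⟨hd, hL⟩
      have hwalk : ∀ u v, ∃ p : G.Walk u v, p.length ≤ d := fun u v =>
        exists_walk_le G hG u v ((SimpleGraph.dist_le_diam
          (SimpleGraph.connected_iff_ediam_ne_top.1 hG)).trans hd)
      obtain ⟨⟨r, hr⟩, huniq⟩ := elect_alive G hid d L hwalk s
      have huniq : ∀ v, (s₁ v).alive → v = r := by
        intro v hv
        apply hid
        apply Nat.eq_of_testBit_eq
        intro i
        by_cases hi : i < L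
        · exact huniq v r hv hr i hi
        · have : ∀ w, (ident w).testBit i = false := fun w =>
            Nat.testBit_eq_false_of_lt (Nat.size_le.1 ((hL w).trans (not_lt.1 hi)))
          rw [this, this]
      have h3 : ∀ v, (s₃ v).wave.depth ≠ none ∧ (s₃ v).wave.val = ident r := by
        intro v
        obtain ⟨p, hp⟩ := hwalk v r
        obtain ⟨h, -, hh⟩ := W.walk p ((h2' r).2 hr) hp
        refine ⟨by rw [hh]; simp, ?_⟩
        obtain ⟨u, hu, hu', -⟩ := W.exists_source hh
        rw [← huniq u ((h2' u).1 hu), ← hu']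
      exact hok fun v => (h4' v).2 ⟨(h3 v).1, hL v, fun u _ => ⟨(h3 u).1,
        (h3 u).2.trans (h3 v).2.symm⟩⟩

/-- At most `S` bits cause a message in the election; the tree wave, the comparison and the alarm
add one each. -/
theorem setup_msgBound (hid : Function.Injective ident) (d L S : ℕ)
    (hS : ∀ v, (ident v).size ≤ S) (s : V → Reg) :
    MsgBound G ident (setup d L) s (S + 3) (fun m => m.size ≤ S) := by
  classical
  have h1 : MsgBound G ident (elect d L) s S (fun m => m.size ≤ S) :=
    (elect_msgBound G hid d L S hS s).mono le_rfl (by rintro _ rfl; simp)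
  set s₁ := exec G ident (elect d L) s with hs₁
  set s₂ := (localStep (fun j _ s =>
    { s with wave := ⟨if s.alive then some 0 else none, 0, j⟩ })).app G ident s₁ with hs₂
  have h20 : ∀ v, (s₂ v).wave.depth = none ∨ (s₂ v).wave.depth = some 0 := by
    intro v; simp only [hs₂, localStep_app]; split_ifs <;> simp
  have h2 : MsgBound G ident (waves d) s₂ 1 (fun m => m.size ≤ S) :=
    waves_msgBound G hid _ h20 d _ fun v _ => hS v
  have W := waves_inv G hid s₂ h20 d
  set s₃ := exec G ident (waves d) s₂ with hs₃
  have h3 : MsgBound G ident [compareStep L] s₃ 1 (fun m => m.size ≤ S) := by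
    refine msgBound_single _ _ _ fun u m x hx => ?_
    simp only [compareStep, Option.map_eq_some_iff] at hx
    obtain ⟨h, hh, rfl⟩ := hx
    obtain ⟨w, -, hw, -⟩ := W.exists_source hh
    rw [← hw]
    exact hS w
  have h4 : MsgBound G ident (waves (2 * d)) ((compareStep L).app G ident s₃) 1
      (fun m => m.size ≤ S) := by
    refine waves_msgBound G hid _ (fun v => ?_) _ _ fun v _ => ?_
    · simp only [Step.app, compareStep]
      split_ifs <;> simp
    · simp [Step.app, compareStep]
  have h5 := localStep_msgBound G (ident := ident) (fun _ _ s =>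
    { s with dep := if s.wave.depth = none then s.dep else none })
    (exec G ident (waves (2 * d)) ((compareStep L).app G ident s₃)) (fun m => m.size ≤ S)
  exact (h1.append (((localStep_msgBound G _ s₁ _).append h2).append ((h3.append h4).append
    h5))).mono (by omega) fun _ h => h

end Network

/-! ### Combinatorics of breadth-first trees -/

/-- Every vertex but the root `r` has a parent in `q`, a neighbour that is closer to `r`. -/
structure BfsTree {V : Type} (G : SimpleGraph V) (r : V) (q : V → V) : Prop where
  adj : ∀ v, v ≠ r → G.Adj (q v) v
  dist : ∀ v, v ≠ r → G.dist r v = G.dist r (q v) + 1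

/-- `c` is a child of `x`. -/
def IsChild {V : Type} (r : V) (q : V → V) (c x : V) : Prop := c ≠ r ∧ q c = x

/-- `v` lies in the subtree of `x`. -/
def Below {V : Type} (r : V) (q : V → V) : V → V → Prop := Relation.ReflTransGen (IsChild r q)

namespace BfsTree

variable {V : Type} {G : SimpleGraph V} {r : V} {q : V → V} (T : BfsTree G r q)

include T

theorem dist_child {c x : V} (h : IsChild r q c x) : G.dist r c = G.dist r x + 1 := by
  rw [T.dist c h.1, h.2]

theorem dist_le {v x : V} (h : Below r q v x) : v = x ∨ G.dist r x < G.dist r v := by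
  induction h with
  | refl => exact Or.inl rfl
  | tail _ h ih =>
    right
    have := T.dist_child h
    rcases ih with rfl | ih <;> omega

theorem eq_of_below {v x y : V} (hx : Below r q v x) (hy : Below r q v y)
    (h : G.dist r x = G.dist r y) : x = y := by
  have hru : Relator.RightUnique (IsChild r q) := fun a b c hb hc => hb.2.symm.trans hc.2
  rcases Relation.ReflTransGen.total_of_right_unique hru hx hy with h' | h'
  · rcases T.dist_le h' with h' | h'
    · exact h'
    · omega
  · rcases T.dist_le h' with h' | h'
    · exact h'.symm
    · omega

theorem child_unique {v x c c' : V} (hc : IsChild r q c x) (hc' : IsChild r q c' x)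
    (h : Below r q v c) (h' : Below r q v c') : c = c' :=
  T.eq_of_below h h' (by rw [T.dist_child hc, T.dist_child hc'])

theorem ne_of_below_child {v x c : V} (hc : IsChild r q c x) (h : Below r q v c) : v ≠ x := by
  rintro rfl
  have := T.dist_child hc
  rcases T.dist_le h with rfl | h <;> omega

theorem ne_root_of_below {v x : V} (hx : x ≠ r) (h : Below r q v x) : v ≠ r := by
  rintro rfl
  rcases T.dist_le h with rfl | h
  · exact hx rfl
  · simp at h

theorem below_root (v : V) : Below r q v r := by
  induction hn : G.dist r v generalizing v with
  | zero =>
    by_cases hv : v = r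
    · rw [hv]; exact .refl
    · have := T.dist v hv; omega
  | succ n ih =>
    have hv : v ≠ r := by rintro rfl; simp at hn
    have := T.dist v hv
    exact .head ⟨hv, rfl⟩ (ih (q v) (by omega))

omit T in
theorem below_iff {v x : V} : Below r q v x ↔ v = x ∨ ∃ c, IsChild r q c x ∧ Below r q v c := by
  constructor
  · intro h
    rcases Relation.ReflTransGen.cases_tail h with h | ⟨c, h1, h2⟩
    · exact Or.inl h.symm
    · exact Or.inr ⟨c, h2, h1⟩
  · rintro (rfl | ⟨c, h1, h2⟩)
    · exact .refl
    · exact .tail h2 h1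

/-- Deeper descendants are at distance at least two from `x`. This is where the breadth-first
property matters: omitting edges to parents hides `x` from the extremal labels of its child
subtrees, and no other edge from them leads to `x`. -/
theorem eq_child_of_adj (hG : G.Connected) {v x c : V} (hc : IsChild r q c x) (h : Below r q v c)
    (hA : G.Adj v x) : v = c := by
  rcases T.dist_le h with h | h
  · exact h
  · have h1 := T.dist_child hc
    have h2 : G.dist r v ≤ G.dist r x + 1 := by
      have := hG.dist_triangle (u := r) (v := x) (w := v)
      rwa [SimpleGraph.dist_eq_one_iff_adj.2 hA.symm] at this
    omega

end BfsTree

/-! ### Preorder labellings -/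

section Labels

variable {V : Type} [Fintype V] {G : SimpleGraph V} {r : V} {q : V → V}

-- The recursion has only one solution, by induction from the deepest vertices upwards, and the
-- subtrees of distinct children are disjoint.
open Classical in
theorem subtree_card (T : BfsTree G r q) (sz : V → ℕ)
    (hsz : ∀ x, sz x = 1 + ∑ c with IsChild r q c x, sz c) (x : V) :
    sz x = (Finset.univ.filter fun v => Below r q v x).card := by
  obtain ⟨M, hM⟩ : ∃ M, ∀ v, G.dist r v ≤ M :=
    ⟨Finset.univ.sup fun v => G.dist r v, fun v => Finset.le_sup (f := fun v => G.dist r v)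
      (Finset.mem_univ v)⟩
  induction hn : M - G.dist r x using Nat.strong_induction_on generalizing x with
  | _ n ih =>
    have hset : (Finset.univ.filter fun v => Below r q v x) = insert x
        ((Finset.univ.filter fun c => IsChild r q c x).biUnion
          fun c => Finset.univ.filter fun v => Below r q v c) := by
      ext v
      simp only [Finset.mem_filter, Finset.mem_univ, true_and, Finset.mem_insert,
        Finset.mem_biUnion]
      exact BfsTree.below_iff
    rw [hset, Finset.card_insert_of_notMem, Finset.card_biUnion, hsz x, add_comm]
    · congr 1
      refine Finset.sum_congr rfl fun c hc => ?_
      have h1 := T.dist_child (Finset.mem_filter.1 hc).2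
      have h2 := hM c
      exact ih _ (by omega) c rfl
    · intro c hc c' hc' hne
      refine Finset.disjoint_left.2 fun v hv hv' => ?_
      exact hne (T.child_unique (Finset.mem_filter.1 hc).2 (Finset.mem_filter.1 hc').2
        (Finset.mem_filter.1 hv).2 (Finset.mem_filter.1 hv').2)
    · intro h
      simp only [Finset.mem_filter, Finset.mem_univ, true_and, Finset.mem_biUnion] at h
      obtain ⟨c, hc, hb⟩ := h
      exact T.ne_of_below_child hc hb rfl

open Classical in
/-- `lab` is a preorder labelling of the tree in which the children of `x` are ordered by
`key x`, and `sz` are the sizes of the subtrees. -/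
structure Labelling {α : Type} [LinearOrder α] (r : V) (q : V → V) (key : V → V → α)
    (sz lab : V → ℕ) : Prop where
  inj : ∀ x, Function.Injective (key x)
  size : ∀ x, sz x = 1 + ∑ c with IsChild r q c x, sz c
  root : lab r = 0
  child : ∀ c x, IsChild r q c x →
    lab c = lab x + 1 + ∑ c' with IsChild r q c' x ∧ key x c' < key x c, sz c'

namespace Labelling

variable {α : Type} [LinearOrder α] {key : V → V → α} {sz lab : V → ℕ}
  (A : Labelling r q key sz lab)

include A

theorem size_pos (x : V) : 0 < sz x := by
  rw [A.size]; omega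

theorem child_le {c x : V} (h : IsChild r q c x) :
    lab x < lab c ∧ lab c + sz c ≤ lab x + sz x := by
  classical
  rw [A.child c x h, A.size x]
  have : ∑ c' with IsChild r q c' x ∧ key x c' < key x c, sz c' + sz c ≤
      ∑ c with IsChild r q c x, sz c := by
    rw [add_comm, ← Finset.sum_insert (by simp)]
    refine Finset.sum_le_sum_of_subset fun v => ?_
    simp only [Finset.mem_insert, Finset.mem_filter, Finset.mem_univ, true_and]
    rintro (rfl | h')
    · exact h
    · exact h'.1
  omega

theorem sibling_le {c c' x : V} (h : IsChild r q c x) (h' : IsChild r q c' x)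
    (hlt : key x c' < key x c) : lab c' + sz c' ≤ lab c := by
  classical
  rw [A.child c x h, A.child c' x h', add_assoc]
  refine Nat.add_le_add_left ?_ _
  rw [add_comm, ← Finset.sum_insert (by simp)]
  refine Finset.sum_le_sum_of_subset fun v => ?_
  simp only [Finset.mem_insert, Finset.mem_filter, Finset.mem_univ, true_and]
  rintro (rfl | h3)
  · exact ⟨h', hlt⟩
  · exact ⟨h3.1, h3.2.trans hlt⟩

theorem below_le {v x : V} (h : Below r q v x) : lab x ≤ lab v ∧ lab v + sz v ≤ lab x + sz x := by
  induction h with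
  | refl => exact ⟨le_rfl, le_rfl⟩
  | tail _ h ih =>
    have := A.child_le h
    omega

/-- Descend from the root to `x`. If `v` is below the parent of `x`, it is the parent or lies in the
subtree of some sibling; the label of the parent is too small, and the intervals of distinct
siblings are disjoint, so that sibling is `x`. -/
theorem below_of_mem (T : BfsTree G r q) {v x : V} (h : lab x ≤ lab v) (h' : lab v < lab x + sz x) :
    Below r q v x := by
  have hx := T.below_root x
  induction hx using Relation.ReflTransGen.head_induction_on with
  | refl => exact T.below_root v
  | head hc _ ih =>
    rename_i x p _
    have h1 := A.child_le hc
    have hv := ih (by omega) (by omega)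
    rcases BfsTree.below_iff.1 hv with rfl | ⟨c', hc', hv'⟩
    · omega
    · have h2 := A.below_le hv'
      have h3 := A.size_pos v
      rcases lt_trichotomy (key p x) (key p c') with hk | hk | hk
      · have := A.sibling_le hc' hc hk; omega
      · rw [A.inj p hk]; exact hv'
      · have := A.sibling_le hc hc' hk; omega

theorem below_iff_mem (T : BfsTree G r q) {v x : V} :
    Below r q v x ↔ lab x ≤ lab v ∧ lab v < lab x + sz x := by
  refine ⟨fun h => ?_, fun h => A.below_of_mem T h.1 h.2⟩
  have := A.below_le h
  have := A.size_pos v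
  omega

theorem size_le (T : BfsTree G r q) (x : V) : sz x ≤ Fintype.card V := by
  classical
  rw [subtree_card T sz A.size x]
  exact Finset.card_le_univ _

theorem lt_card (T : BfsTree G r q) (x : V) : lab x < Fintype.card V := by
  have h1 := A.below_le (T.below_root x)
  have h2 := A.size_pos x
  have h3 := A.size_le T r
  have h4 := A.root
  omega

end Labelling

end Labels

/-! ### Links between the parts left by deleting a vertex -/

section Links

variable {V : Type} {G : SimpleGraph V} {r : V} {q : V → V} {ident : V → ℕ}

/-- `f v` is extremal, with respect to the order `R`, among the labels of the subtree of `v` and of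
the neighbours of its vertices, where the edges to the parents are ignored. -/
structure Extremal (G : SimpleGraph V) (r : V) (q : V → V) (R : ℕ → ℕ → Prop) (lab f : V → ℕ) :
    Prop where
  nbr : ∀ v w, v ≠ r → G.Adj v w → w ≠ q v → R (f v) (lab w)
  child : ∀ c x, IsChild r q c x → R (f x) (f c)
  attained : ∀ v, v ≠ r → f v = lab v ∨ (∃ w, G.Adj v w ∧ w ≠ q v ∧ f v = lab w) ∨
    ∃ c, IsChild r q c v ∧ f v = f c

theorem Extremal.below {R : ℕ → ℕ → Prop} [Std.Refl R] [IsTrans ℕ R] {lab f : V → ℕ}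
    (E : Extremal G r q R lab f) (T : BfsTree G r q) {v w x : V} (hx : x ≠ r) (h : Below r q v x)
    (hA : G.Adj v w) (hw : w ≠ q v) : R (f x) (lab w) := by
  have : R (f x) (f v) := by
    induction h with
    | refl => exact refl _
    | tail _ hc ih => exact _root_.trans (E.child _ _ hc) (ih hc.1)
  exact _root_.trans this (E.nbr v w (T.ne_root_of_below hx h) hA hw)

/-- Follow `attained` from child to child; bounded depth ends the descent at a vertex that
contributes its own label or that of a neighbour. -/
theorem Extremal.exists_below [Finite V] {R : ℕ → ℕ → Prop} {lab f : V → ℕ}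
    (E : Extremal G r q R lab f) (T : BfsTree G r q) (x : V) (hx : x ≠ r) :
    ∃ v w, Below r q v x ∧ f x = lab w ∧ (w = v ∨ G.Adj v w ∧ w ≠ q v) := by
  obtain ⟨M, hM⟩ : ∃ M, ∀ v, G.dist r v ≤ M := by
    obtain ⟨M, hM⟩ := (Set.finite_range fun v => G.dist r v).bddAbove
    exact ⟨M, fun v => hM ⟨v, rfl⟩⟩
  induction hn : M - G.dist r x using Nat.strong_induction_on generalizing x with
  | _ n ih =>
    rcases E.attained x hx with h | ⟨w, h1, h2, h3⟩ | ⟨c, h1, h2⟩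
    · exact ⟨x, x, .refl, h, Or.inl rfl⟩
    · exact ⟨x, w, .refl, h3, Or.inr ⟨h1, h2⟩⟩
    · have h3 := T.dist_child h1
      have h4 := hM c
      obtain ⟨v, w, h5, h6, h7⟩ := ih _ (by omega) c h1.1 rfl
      exact ⟨v, w, .tail h5 h1, h2.trans h6, h7⟩

/-- A label lies in a part: the subtree of a child of `x`, or the outside of the subtree of `x`. -/
def InPart (ident : V → ℕ) (r : V) (q : V → V) (sz lab : V → ℕ) (x : V) (l : ℕ) :
    Option ℕ → Prop
  | some m => ∃ c, IsChild r q c x ∧ ident c = m ∧ lab c ≤ l ∧ l < lab c + sz c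
  | none => l < lab x ∨ lab x + sz x ≤ l

/-- The links at `x` known after learning the extremal labels of the children. -/
def NewLink (ident : V → ℕ) (r : V) (q : V → V) (sz lab lo hi : V → ℕ) (x : V)
    (K : Option ℕ → Option ℕ → Prop) (a b : Option ℕ) : Prop :=
  K a b ∨ ∃ c, IsChild r q c x ∧ a = some (ident c) ∧
    (InPart ident r q sz lab x (lo c) b ∨ InPart ident r q sz lab x (hi c) b)

/-- The least identifier in the class of `m`. -/
noncomputable def classRep (K : Option ℕ → Option ℕ → Prop) (m : ℕ) : ℕ :=
  sInf {m' | Relation.EqvGen K (some m) (some m')}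

theorem classRep_eq_iff (K : Option ℕ → Option ℕ → Prop) (m m' : ℕ) :
    classRep K m = classRep K m' ↔ Relation.EqvGen K (some m) (some m') := by
  have hmem : ∀ m, Relation.EqvGen K (some m) (some (classRep K m)) := fun m =>
    Nat.sInf_mem (s := {m' | Relation.EqvGen K (some m) (some m')}) ⟨m, .refl _⟩
  constructor
  · intro h
    exact .trans _ _ _ (hmem m) (h ▸ .symm _ _ (hmem m'))
  · intro h
    unfold classRep
    congr 1
    ext j
    exact ⟨fun h' => .trans _ _ _ (.symm _ _ h) h', fun h' => .trans _ _ _ h h'⟩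

/-- The order of the children: by classes, then by identifiers. -/
noncomputable def childKey (K : Option ℕ → Option ℕ → Prop) (m : ℕ) : ℕ ×ₗ ℕ :=
  -- With the class as leading component, the children of a class are consecutive, so their subtrees
  -- fill an interval of labels that meets no other part.
  toLex (classRep K m, m)

theorem childKey_injective (K : Option ℕ → Option ℕ → Prop) : Function.Injective (childKey K) := by
  intro m m' h
  exact congrArg (fun p => (ofLex p).2) h

theorem childKey_lt {K : Option ℕ → Option ℕ → Prop} {m m' : ℕ}
    (h : classRep K m < classRep K m') : childKey K m < childKey K m' :=
  Prod.Lex.toLex_lt_toLex.2 (Or.inl h)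

/-- Connectivity in `G` without `x`. -/
def ConnAvoiding (G : SimpleGraph V) (x : V) : V → V → Prop :=
  Relation.EqvGen fun u w => G.Adj u w ∧ u ≠ x ∧ w ≠ x

theorem preconnected_induce_iff (x : V) : (G.induce {x}ᶜ).Preconnected ↔
    ∀ u w, u ≠ x → w ≠ x → ConnAvoiding G x u w := by
  constructor
  · intro h u w hu hw
    obtain ⟨p⟩ := h ⟨u, hu⟩ ⟨w, hw⟩
    have : ∀ a b : ({x}ᶜ : Set V), (G.induce {x}ᶜ).Walk a b → ConnAvoiding G x a b := by
      intro a b p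
      induction p with
      | nil => exact .refl _
      | @cons a b c hA _ ih => exact .trans _ _ _ (.rel _ _ ⟨hA, a.2, b.2⟩) ih
    exact this _ _ p
  · rintro h ⟨u, hu⟩ ⟨w, hw⟩
    have : ∀ a b, ConnAvoiding G x a b → a = b ∨ ∃ (ha : a ≠ x) (hb : b ≠ x),
        (G.induce {x}ᶜ).Reachable ⟨a, ha⟩ ⟨b, hb⟩ := by
      intro a b hab
      induction hab with
      | rel a b h => exact Or.inr ⟨h.2.1, h.2.2, SimpleGraph.Adj.reachable h.1⟩
      | refl a => exact Or.inl rfl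
      | symm a b _ ih =>
        rcases ih with rfl | ⟨h1, h2, h3⟩
        · exact Or.inl rfl
        · exact Or.inr ⟨h2, h1, h3.symm⟩
      | trans a b c _ _ ih ih' =>
        rcases ih with rfl | ⟨h1, h2, h3⟩
        · exact ih'
        · rcases ih' with rfl | ⟨h4, h5, h6⟩
          · exact Or.inr ⟨h1, h2, h3⟩
          · exact Or.inr ⟨h1, h5, h3.trans h6⟩
    rcases this u w (h u w hu hw) with rfl | ⟨_, _, h⟩
    · exact .refl _
    · exact h

/-- Otherwise membership in `U` would be invariant under the generating relation. -/
theorem exists_boundary {x u w : V} (h : ConnAvoiding G x u w) (U : Set V) (hu : u ∈ U)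
    (hw : w ∉ U) : ∃ a b, a ∈ U ∧ b ∉ U ∧ G.Adj a b ∧ a ≠ x ∧ b ≠ x := by
  by_contra hcon
  have : ∀ a b, ConnAvoiding G x a b → (a ∈ U ↔ b ∈ U) := by
    intro a b hab
    induction hab with
    | rel a b h =>
      constructor
      · intro ha
        by_contra hb
        exact hcon ⟨a, b, ha, hb, h.1, h.2.1, h.2.2⟩
      · intro hb
        by_contra ha
        exact hcon ⟨b, a, hb, ha, h.1.symm, h.2.2, h.2.1⟩
    | refl a => rfl
    | symm a b _ ih => exact ih.symm
    | trans a b c _ _ ih ih' => exact ih.trans ih'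
  exact hw ((this u w h).1 hu)

theorem connAvoiding_child (T : BfsTree G r q) {v c x : V} (hc : IsChild r q c x)
    (h : Below r q v c) : ConnAvoiding G x v c := by
  induction h using Relation.ReflTransGen.head_induction_on with
  | refl => exact .refl _
  | head ha hb ih =>
    rename_i a b
    refine .trans _ _ _ (.rel _ _ ⟨?_, T.ne_of_below_child hc (.head ha hb),
      T.ne_of_below_child hc hb⟩) ih
    rw [← ha.2]
    exact (T.adj a ha.1).symm

/-- The tree path from `v` to the root cannot meet `x`, since only descendants of `x` pass through
it. -/
theorem connAvoiding_root (T : BfsTree G r q) {v x : V} (h : ¬ Below r q v x) :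
    ConnAvoiding G x v r := by
  have hv := T.below_root v
  induction hv using Relation.ReflTransGen.head_induction_on with
  | refl => exact .refl _
  | head ha hb ih =>
    rename_i a b
    have hb' : ¬ Below r q b x := fun h' => h (.head ha h')
    refine .trans _ _ _ (.rel _ _ ⟨?_, ?_, ?_⟩) (ih hb')
    · rw [← ha.2]
      exact (T.adj a ha.1).symm
    · rintro rfl; exact h .refl
    · rintro rfl; exact hb' .refl

/-- The links known initially: at the root, the least child takes the role of the outside. -/
def InitLink (ident : V → ℕ) (r : V) (q : V → V) (x : V) (a b : Option ℕ) : Prop :=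
  x = r ∧ a = none ∧ ∃ c, IsChild r q c x ∧ b = some (ident c) ∧
    ∀ c', IsChild r q c' x → ident c ≤ ident c'

/-- The links in `K` join parts that are connected in `G` without `x`, where `z` represents the
outside. -/
def SoundLink (G : SimpleGraph V) (ident : V → ℕ) (x z : V)
    (K : Option ℕ → Option ℕ → Prop) : Prop :=
  ∀ a b, K a b → ∃ u w, ConnAvoiding G x u w ∧
    (a.elim (u = z) fun m => ident u = m) ∧ (b.elim (w = z) fun m => ident w = m)

/-- `z` is a representative of the outside of the subtree of `x`. -/
def IsBase (ident : V → ℕ) (r : V) (q : V → V) (x z : V) : Prop :=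
  (x ≠ r → z = r) ∧ (x = r → ∀ c, IsChild r q c x → IsChild r q z x ∧
    ∀ c', IsChild r q c' x → ident z ≤ ident c')

theorem exists_isBase (ident : V → ℕ) (r : V) (q : V → V) (x : V) :
    ∃ z, IsBase ident r q x z := by
  by_cases hx : x = r
  · by_cases hc : ∃ c, IsChild r q c x
    · have hne : (ident '' {c | IsChild r q c x}).Nonempty := by
        obtain ⟨c, hc⟩ := hc; exact ⟨_, c, hc, rfl⟩
      obtain ⟨z, hz, hz'⟩ := Nat.sInf_mem hne
      refine ⟨z, fun h => absurd hx h, fun _ _ _ => ⟨hz, fun c' hc' => ?_⟩⟩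
      rw [hz']
      exact Nat.sInf_le ⟨c', hc', rfl⟩
    · exact ⟨r, fun _ => rfl, fun _ c h => absurd ⟨c, h⟩ hc⟩
  · exact ⟨r, fun _ => rfl, fun h => absurd h hx⟩

theorem soundLink_init (hid : Function.Injective ident) {x z : V} (hz : IsBase ident r q x z) :
    SoundLink G ident x z (InitLink ident r q x) := by
  rintro a b ⟨hx, rfl, c, hc, rfl, hmin⟩
  obtain ⟨h1, h2⟩ := hz.2 hx c hc
  have : z = c := hid (le_antisymm (h2 c hc) (hmin z h1))
  subst this
  exact ⟨z, z, .refl _, rfl, rfl⟩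

/-- Injectivity of `ident` makes the representative of a part unique, so connections obtained from
consecutive links can be concatenated. -/
theorem SoundLink.eqvGen (hid : Function.Injective ident) {x z : V}
    {K : Option ℕ → Option ℕ → Prop} (hK : SoundLink G ident x z K) (c : V)
    (h : Relation.EqvGen K (some (ident c)) none) : ConnAvoiding G x c z := by
  have huniq : ∀ a : Option ℕ, ∀ u u', (a.elim (u = z) fun m => ident u = m) →
      (a.elim (u' = z) fun m => ident u' = m) → u = u' := by
    intro a u u' hu hu'
    cases a with
    | none => exact Eq.trans hu (Eq.symm hu')
    | some m => exact hid (Eq.trans hu (Eq.symm hu'))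
  have : ∀ a b, Relation.EqvGen K a b → a = b ∨ ∃ u w, ConnAvoiding G x u w ∧
      (a.elim (u = z) fun m => ident u = m) ∧ (b.elim (w = z) fun m => ident w = m) := by
    intro a b hab
    induction hab with
    | rel a b h => exact Or.inr (hK a b h)
    | refl a => exact Or.inl rfl
    | symm a b _ ih =>
      rcases ih with rfl | ⟨u, w, h1, h2, h3⟩
      · exact Or.inl rfl
      · exact Or.inr ⟨w, u, .symm _ _ h1, h3, h2⟩
    | trans a b c _ _ ih ih' =>
      rcases ih with rfl | ⟨u, w, h1, h2, h3⟩
      · exact ih'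
      · rcases ih' with rfl | ⟨u', w', h4, h5, h6⟩
        · exact Or.inr ⟨u, w, h1, h2, h3⟩
        · obtain rfl := huniq b w u' h3 h5
          exact Or.inr ⟨u, w', .trans _ _ _ h1 h4, h2, h6⟩
  rcases this _ _ h with h | ⟨u, w, h1, h2, h3⟩
  · cases h
  · obtain rfl : u = c := hid h2
    obtain rfl : w = z := h3
    exact h1

section Step

variable [Fintype V] {α : Type} [LinearOrder α] {key : V → V → α} {sz lab lo hi : V → ℕ}

/-- The extremal label belongs to a vertex of the subtree of `c` or to a neighbour of one. It is
never that of `x`, because the only edge from the subtree to `x` is the omitted edge from `c` to its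
parent. -/
theorem Extremal.exists_part (hG : G.Connected) (T : BfsTree G r q) {R : ℕ → ℕ → Prop} {f : V → ℕ} (E : Extremal G r q R lab f)
    {c x : V} (hc : IsChild r q c x) :
    ∃ w, w ≠ x ∧ f c = lab w ∧ ConnAvoiding G x c w := by
  obtain ⟨v, w, h1, h2, h3⟩ := E.exists_below T c hc.1
  have hv := T.ne_of_below_child hc h1
  have hcv := Relation.EqvGen.symm _ _ (connAvoiding_child T hc h1)
  rcases h3 with rfl | ⟨hA, hw⟩
  · exact ⟨w, hv, h2, hcv⟩
  · have hwx : w ≠ x := by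
      rintro rfl
      have := T.eq_child_of_adj hG hc h1 hA
      subst this
      exact hw hc.2.symm
    exact ⟨w, hwx, h2, .trans _ _ _ hcv (.rel _ _ ⟨hA, hv, hwx⟩)⟩

theorem InPart.conn (T : BfsTree G r q) (A : Labelling r q key sz lab) {x z w : V}
    (hz : IsBase ident r q x z) {b : Option ℕ}
    (hb : InPart ident r q sz lab x (lab w) b) : ∃ w', ConnAvoiding G x w w' ∧
      (b.elim (w' = z) fun m => ident w' = m) := by
  cases b with
  | some m =>
    obtain ⟨c, hc, hm, h1, h2⟩ := hb
    exact ⟨c, connAvoiding_child T hc ((A.below_iff_mem T).2 ⟨h1, h2⟩), hm⟩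
  | none =>
    have hnb : ¬ Below r q w x := by
      rw [A.below_iff_mem T]
      rcases hb with h | h <;> omega
    have hx : x ≠ r := by
      rintro rfl; exact hnb (T.below_root w)
    exact ⟨r, connAvoiding_root T hnb, (hz.1 hx).symm⟩

/-- A reported label belongs to a vertex connected to `c` without `x`, and every part is connected
without `x` to its representative. Soundness needs no particular order of the children. -/
theorem SoundLink.newLink (hG : G.Connected) (T : BfsTree G r q) (A : Labelling r q key sz lab)
    {R R' : ℕ → ℕ → Prop} (E : Extremal G r q R lab lo) (E' : Extremal G r q R' lab hi) {x z : V}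
    (hz : IsBase ident r q x z) {K : Option ℕ → Option ℕ → Prop}
    (hK : SoundLink G ident x z K) :
    SoundLink G ident x z (NewLink ident r q sz lab lo hi x K) := by
  rintro a b (h | ⟨c, hc, rfl, h⟩)
  · exact hK a b h
  · have key : ∃ w, ConnAvoiding G x c w ∧ InPart ident r q sz lab x (lab w) b := by
      rcases h with h | h
      · obtain ⟨w, -, h1, h2⟩ := E.exists_part hG T hc
        exact ⟨w, h2, h1 ▸ h⟩
      · obtain ⟨w, -, h1, h2⟩ := E'.exists_part hG T hc
        exact ⟨w, h2, h1 ▸ h⟩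
    obtain ⟨w, h1, h2⟩ := key
    obtain ⟨w', h3, h4⟩ := InPart.conn T A hz h2
    exact ⟨c, w', .trans _ _ _ h1 h3, rfl, h4⟩

theorem exists_inPart (T : BfsTree G r q) (A : Labelling r q key sz lab) {x w : V} (hw : w ≠ x) :
    ∃ b, InPart ident r q sz lab x (lab w) b := by
  by_cases h : Below r q w x
  · rcases BfsTree.below_iff.1 h with h | ⟨c, hc, h⟩
    · exact absurd h hw
    · exact ⟨some (ident c), c, hc, rfl, (A.below_iff_mem T).1 h⟩
  · refine ⟨none, ?_⟩
    rw [A.below_iff_mem T] at h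
    simp only [InPart]
    omega

open Classical in
/-- Every class of children that is not linked to the outside has at least `N` elements. -/
def ClassBound (ident : V → ℕ) (r : V) (q : V → V) (x : V) (K : Option ℕ → Option ℕ → Prop)
    (N : ℕ) : Prop :=
  ∀ c, IsChild r q c x → ¬ Relation.EqvGen K (some (ident c)) none →
    N ≤ (Finset.univ.filter fun c' => IsChild r q c' x ∧
      Relation.EqvGen K (some (ident c)) (some (ident c'))).card

theorem classBound_one (x : V) (K : Option ℕ → Option ℕ → Prop) :
    ClassBound ident r q x K 1 := by
  classical
  intro c hc _
  exact Finset.card_pos.2 ⟨c, by simpa using ⟨hc, .refl _⟩⟩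

/-- A class that is not linked to the outside finds a new link. -/
theorem exists_newLink (hG : G.Connected) (T : BfsTree G r q)
    {K : V → Option ℕ → Option ℕ → Prop}
    (A : Labelling r q (fun x c => childKey (K x) (ident c)) sz lab)
    (E : Extremal G r q (· ≤ ·) lab lo) (E' : Extremal G r q (· ≥ ·) lab hi) {x : V}
    (hinit : ∀ a b, InitLink ident r q x a b → K x a b)
    (hconn : ∀ u w, u ≠ x → w ≠ x → ConnAvoiding G x u w) {c : V} (hc : IsChild r q c x)
    (hn : ¬ Relation.EqvGen (K x) (some (ident c)) none) :
    ∃ c₁ b, IsChild r q c₁ x ∧ Relation.EqvGen (K x) (some (ident c)) (some (ident c₁)) ∧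
      NewLink ident r q sz lab lo hi x (K x) (some (ident c₁)) b ∧
      ¬ Relation.EqvGen (K x) (some (ident c)) b ∧
      (b = none ∨ ∃ c₂, IsChild r q c₂ x ∧ b = some (ident c₂)) := by
  set Q : V → Prop := fun c' => IsChild r q c' x ∧
    Relation.EqvGen (K x) (some (ident c)) (some (ident c')) with hQ
  set U : Set V := {v | ∃ c', Q c' ∧ Below r q v c'} with hU
  have hcU : c ∈ U := ⟨c, ⟨hc, .refl _⟩, .refl⟩
  -- At the root the least child serves: it is linked to `none` initially, so it is not in this
  -- class. Elsewhere the root of the tree serves.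
  have hout : ∃ z, z ≠ x ∧ z ∉ U := by
    by_cases hx : x = r
    · obtain ⟨z, hz⟩ := exists_isBase ident r q x
      obtain ⟨h1, h2⟩ := hz.2 hx c hc
      refine ⟨z, ?_, ?_⟩
      · rintro rfl; exact h1.1 hx
      · rintro ⟨c', hc', hb⟩
        obtain rfl := T.child_unique h1 hc'.1 .refl hb
        exact hn (.trans _ _ _ hc'.2 (.symm _ _ (.rel _ _ (hinit _ _ ⟨hx, rfl, z, h1, rfl, h2⟩))))
    · refine ⟨r, Ne.symm hx, ?_⟩
      rintro ⟨c', hc', hb⟩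
      exact T.ne_root_of_below hc'.1.1 hb rfl
  obtain ⟨z, hzx, hzU⟩ := hout
  obtain ⟨v, w, hv, hw, hA, hvx, hwx⟩ :=
    exists_boundary (hconn c z (T.ne_of_below_child hc .refl) hzx) U hcU hzU
  obtain ⟨c₁, hc₁, hvc₁⟩ := hv
  -- The edge that leaves `U` is not an omitted one: the parent of `v` is either `x` or again in
  -- `U`.
  have hwq : w ≠ q v := by
    rintro rfl
    rcases Relation.ReflTransGen.cases_head hvc₁ with h | ⟨y, hy, hy'⟩
    · subst h; exact hwx hc₁.1.2
    · rw [← hy.2] at hy'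
      exact hw ⟨c₁, hc₁, hy'⟩
  -- The label of `w` lies entirely on one side of the class: `w` is below a child from another
  -- class, which comes before or after the whole class, or it is outside the subtree of `x`.
  have hsep : (∀ c', Q c' → lab w < lab c') ∨ (∀ c', Q c' → lab c' + sz c' ≤ lab w) := by
    by_cases hb : Below r q w x
    · rcases BfsTree.below_iff.1 hb with h | ⟨c₂, hc₂, hwc₂⟩
      · exact absurd h hwx
      · have hnQ : ¬ Relation.EqvGen (K x) (some (ident c)) (some (ident c₂)) :=
          fun h => hw ⟨c₂, ⟨hc₂, h⟩, hwc₂⟩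
        have h2 := (A.below_iff_mem T).1 hwc₂
        have hrep : ∀ c', Q c' → classRep (K x) (ident c') = classRep (K x) (ident c) :=
          fun c' hc' => ((classRep_eq_iff _ _ _).2 hc'.2).symm
        rcases lt_trichotomy (classRep (K x) (ident c₂)) (classRep (K x) (ident c)) with h | h | h
        · left
          intro c' hc'
          have := A.sibling_le hc'.1 hc₂ (childKey_lt (by rw [hrep c' hc']; exact h))
          omega
        · exact absurd ((classRep_eq_iff _ _ _).1 h.symm) hnQ
        · right
          intro c' hc'
          have := A.sibling_le hc₂ hc'.1 (childKey_lt (by rw [hrep c' hc']; exact h))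
          omega
    · rw [A.below_iff_mem T] at hb
      by_cases h : lab w < lab x
      · left
        intro c' hc'
        have := A.child_le hc'.1
        omega
      · right
        intro c' hc'
        have := A.child_le hc'.1
        omega
  -- The extremal label on that side is at least as extreme as that of `w`, so it too is outside the
  -- class. Its vertex may differ from `w`; any vertex in another part will do.
  have hfin : ∃ w', w' ≠ x ∧ (lo c₁ = lab w' ∨ hi c₁ = lab w') ∧
      ∀ c', Q c' → ¬ (lab c' ≤ lab w' ∧ lab w' < lab c' + sz c') := by
    rcases hsep with h | h
    · obtain ⟨w', h1, h2, -⟩ := E.exists_part hG T hc₁.1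
      have h3 : lo c₁ ≤ lab w := E.below T hc₁.1.1 hvc₁ hA hwq
      refine ⟨w', h1, Or.inl h2, fun c' hc' => ?_⟩
      have := h c' hc'
      omega
    · obtain ⟨w', h1, h2, -⟩ := E'.exists_part hG T hc₁.1
      have h3 : hi c₁ ≥ lab w := E'.below T hc₁.1.1 hvc₁ hA hwq
      refine ⟨w', h1, Or.inr h2, fun c' hc' => ?_⟩
      have := h c' hc'
      omega
  obtain ⟨w', hw'x, hlo, hnot⟩ := hfin
  obtain ⟨b, hb⟩ := exists_inPart (ident := ident) T A hw'x
  refine ⟨c₁, b, hc₁.1, hc₁.2, Or.inr ⟨c₁, hc₁.1, rfl, ?_⟩, ?_, ?_⟩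
  · rcases hlo with h | h
    · left; rw [h]; exact hb
    · right; rw [h]; exact hb
  · intro h
    cases b with
    | none => exact hn h
    | some m =>
      obtain ⟨c₂, hc₂, rfl, h3⟩ := hb
      exact hnot c₂ ⟨hc₂, h⟩ h3
  · cases b with
    | none => exact Or.inl rfl
    | some m =>
      obtain ⟨c₂, hc₂, rfl, h3⟩ := hb
      exact Or.inr ⟨c₂, hc₂, rfl⟩

/-- A new class still not linked to the outside contains its old class and the disjoint old class
that `exists_newLink` joins to it, and neither was linked to the outside. For a cut vertex this may
fail, since a class can already be a whole component; hence the hypothesis `hconn`. -/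
theorem ClassBound.newLink (hG : G.Connected) (T : BfsTree G r q)
    {K : V → Option ℕ → Option ℕ → Prop}
    (A : Labelling r q (fun x c => childKey (K x) (ident c)) sz lab)
    (E : Extremal G r q (· ≤ ·) lab lo) (E' : Extremal G r q (· ≥ ·) lab hi) {x : V}
    (hinit : ∀ a b, InitLink ident r q x a b → K x a b)
    (hconn : ∀ u w, u ≠ x → w ≠ x → ConnAvoiding G x u w) {N : ℕ}
    (hB : ClassBound ident r q x (K x) N) :
    ClassBound ident r q x (NewLink ident r q sz lab lo hi x (K x)) (2 * N) := by
  classical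
  intro c hc hn
  have hmono : ∀ a b, Relation.EqvGen (K x) a b →
      Relation.EqvGen (NewLink ident r q sz lab lo hi x (K x)) a b :=
    Relation.EqvGen.mono fun _ _ h => Or.inl h
  have hn' : ¬ Relation.EqvGen (K x) (some (ident c)) none := fun h => hn (hmono _ _ h)
  obtain ⟨c₁, b, h1, h2, h3, h4, h5⟩ := exists_newLink hG T A E E' hinit hconn hc hn'
  have hcb : Relation.EqvGen (NewLink ident r q sz lab lo hi x (K x)) (some (ident c)) b :=
    .trans _ _ _ (hmono _ _ h2) (.rel _ _ h3)
  rcases h5 with rfl | ⟨c₂, hc₂, rfl⟩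
  · exact absurd hcb hn
  · have hn₂ : ¬ Relation.EqvGen (K x) (some (ident c₂)) none :=
      fun h => hn (.trans _ _ _ hcb (hmono _ _ h))
    have hb₁ := hB c hc hn'
    have hb₂ := hB c₂ hc₂ hn₂
    rw [two_mul]
    refine (Nat.add_le_add hb₁ hb₂).trans ?_
    rw [← Finset.card_union_of_disjoint]
    · refine Finset.card_le_card fun c' hc' => ?_
      simp only [Finset.mem_union, Finset.mem_filter, Finset.mem_univ, true_and] at hc' ⊢
      rcases hc' with h | h
      · exact ⟨h.1, hmono _ _ h.2⟩
      · exact ⟨h.1, .trans _ _ _ hcb (hmono _ _ h.2)⟩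
    · rw [Finset.disjoint_left]
      intro c' h h'
      simp only [Finset.mem_filter, Finset.mem_univ, true_and] at h h'
      exact h4 (.trans _ _ _ h.2 (.symm _ _ h'.2))

/-- Once the class bound exceeds the number of vertices, the links decide whether `x` is a cut
vertex. -/
theorem isCutVertex_iff_link (hid : Function.Injective ident) (T : BfsTree G r q)
    {x z : V} (hz : IsBase ident r q x z) {K : Option ℕ → Option ℕ → Prop}
    (hK : SoundLink G ident x z K) {N : ℕ} (hN : Fintype.card V ≤ N)
    (hB : (∀ u w, u ≠ x → w ≠ x → ConnAvoiding G x u w) → ClassBound ident r q x K N) :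
    IsCutVertex G x ↔
      ∃ c, IsChild r q c x ∧ ¬ Relation.EqvGen K (some (ident c)) none := by
  classical
  rw [IsCutVertex, preconnected_induce_iff]
  constructor
  · intro hcut
    by_contra hcon
    push Not at hcon
    apply hcut
    have hall : ∀ v, v ≠ x → ConnAvoiding G x v z := by
      intro v hv
      by_cases hb : Below r q v x
      · rcases BfsTree.below_iff.1 hb with h | ⟨c, hc, h⟩
        · exact absurd h hv
        · exact .trans _ _ _ (connAvoiding_child T hc h) (hK.eqvGen hid c (hcon c hc))
      · have hx : x ≠ r := by rintro rfl; exact hb (T.below_root v)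
        rw [hz.1 hx]
        exact connAvoiding_root T hb
    exact fun u w hu hw => .trans _ _ _ (hall u hu) (.symm _ _ (hall w hw))
  · rintro ⟨c, hc, hn⟩ hconn
    have h1 := hB hconn c hc hn
    -- An unlinked class would contain at least `n` children, but `x` is not a child of itself.
    have h2 : (Finset.univ.filter fun c' => IsChild r q c' x ∧
        Relation.EqvGen K (some (ident c)) (some (ident c'))).card < Fintype.card V := by
      refine Finset.card_lt_univ_of_notMem (x := x) ?_
      simp only [Finset.mem_filter, Finset.mem_univ, true_and]
      rintro ⟨h, -⟩
      exact T.ne_of_below_child h .refl rfl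
    omega

end Step

end Links

/-! ### Protocols on the tree -/

open Classical in
/-- A round of a convergecast: the nodes at depth `j + 1` report to their parents. -/
noncomputable def convStep (get : Reg → ℕ) (upd : Finset ℕ → Reg → (ℕ → Option ℕ) → Reg)
    (j : ℕ) : Step Reg where
  send _ _ s m := if s.dep = some (j + 1) ∧ m = s.par then some (get s) else none
  recv _ N s I := if s.dep = some j then upd N s I else s

/-- A convergecast in the nodes at depth less than `k`. -/
noncomputable def convs (get : Reg → ℕ) (upd : Finset ℕ → Reg → (ℕ → Option ℕ) → Reg)
    (k : ℕ) : List (Step Reg) := (List.range k).reverse.map (convStep get upd)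

/-- The label that a node assigns to its child with identifier `m`. -/
noncomputable def childLabel (N : Finset ℕ) (s : Reg) (m : ℕ) : ℕ :=
  s.lab + 1 + ∑ m' ∈ N with childKey s.link m' < childKey s.link m, (s.csz m').getD 0

open Classical in
/-- A round of the broadcast of labels. -/
noncomputable def labelStep (j : ℕ) : Step Reg where
  send _ N s m := if s.dep = some j ∧ s.csz m ≠ none then some (childLabel N s m) else none
  recv _ _ s I := if s.dep = some (j + 1) then { s with lab := (I s.par).getD 0 } else s

/-- The broadcast of labels in the tree to depth `k`. -/
noncomputable def labels (k : ℕ) : List (Step Reg) := (List.range k).map labelStep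

open Classical in
/-- The exchange of the labels along all edges. -/
noncomputable def exchangeStep : Step Reg where
  send _ _ s _ := if s.dep = none then none else some s.lab
  recv _ N s I := { s with
    -- At the root `s.par` has no meaning and may exclude an arbitrary neighbour; `Extremal` asks
    -- nothing about the root's own edges.
    lo := N.fold min s.lab fun m => if m = s.par then s.lab else (I m).getD s.lab
    hi := N.fold max s.lab fun m => if m = s.par then s.lab else (I m).getD s.lab }

/-- Processing the reports about the sizes of subtrees. -/
noncomputable def sizeUpd (N : Finset ℕ) (s : Reg) (I : ℕ → Option ℕ) : Reg :=
  { s with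
    sz := 1 + ∑ m ∈ N, (I m).getD 0
    csz := I
    -- The broadcast never relabels the root, so this zero remains its label in all phases of the
    -- trial.
    lab := 0
    link := fun a b => s.dep = some 0 ∧ a = none ∧ ∃ m, b = some m ∧ I m ≠ none ∧
      ∀ m', I m' ≠ none → m ≤ m' }

/-- A label lies in the subtree of a child or outside the own subtree. -/
def InPartLocal (N : Finset ℕ) (s : Reg) (l : ℕ) : Option ℕ → Prop
  | some m => ∃ z, s.csz m = some z ∧ childLabel N s m ≤ l ∧ l < childLabel N s m + z
  | none => l < s.lab ∨ s.lab + s.sz ≤ l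

/-- Processing the reports about the extremal labels. -/
noncomputable def linkUpd (N : Finset ℕ) (s : Reg) (I : ℕ → Option ℕ) : Reg :=
  { s with
    lo := N.fold min s.lo fun m => ((I m).map fun y => y.unpair.1).getD s.lo
    hi := N.fold max s.hi fun m => ((I m).map fun y => y.unpair.2).getD s.hi
    link := fun a b => s.link a b ∨ ∃ m y, I m = some y ∧ a = some m ∧
      (InPartLocal N s y.unpair.1 b ∨ InPartLocal N s y.unpair.2 b) }

/-- A phase: labelling and search for new links. -/
noncomputable def phase (d : ℕ) : List (Step Reg) :=
  labels d ++ exchangeStep :: convs (fun s => Nat.pair s.lo s.hi) linkUpd (d + 1)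

open Classical in
/-- The output of a node: some child subtree is not linked to the outside. -/
noncomputable def verdict (s : Reg) : Option Bool :=
  if s.dep = none then none
  else some (decide (∃ m, s.csz m ≠ none ∧ ¬ Relation.EqvGen s.link (some m) none))

/-- The output is computed from the links. -/
noncomputable def finishStep : Step Reg := localStep fun _ _ s => { s with out := verdict s }

/-- The computation in the tree, before the output. -/
noncomputable def treeWork (d L : ℕ) : List (Step Reg) :=
  -- With `d + 1` rather than `d`, nodes at depth `d` also perform an update: they receive no report
  -- but must set their size to 1.
  convs Reg.sz sizeUpd (d + 1) ++ (List.range L).flatMap fun _ => phase d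

/-! ### Correctness of the tree protocols -/

section Tree

variable {V : Type} {G : SimpleGraph V} {ident : V → ℕ} {r : V} {q : V → V}

theorem IsTree.bfsTree {s : V → Reg} (h : IsTree G ident r q s) : BfsTree G r q := ⟨h.adj, h.dist⟩

theorem IsTree.congr {s s' : V → Reg} (h : IsTree G ident r q s)
    (hs : ∀ v, (s' v).dep = (s v).dep ∧ (s' v).par = (s v).par) : IsTree G ident r q s' :=
  ⟨fun v => (hs v).1.trans (h.dep v), h.adj, h.dist, fun v hv => (hs v).2.trans (h.par v hv)⟩

open Classical in
variable (ident r q) in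
/-- The reports received from the children when the value of each vertex is given by `f`. -/
noncomputable def childBox (f : V → ℕ) (v : V) : ℕ → Option ℕ :=
  Function.extend ident (fun c => if IsChild r q c v then some (f c) else none) fun _ => none

theorem childBox_ident (hid : Function.Injective ident) (f : V → ℕ) (v c : V)
    [Decidable (IsChild r q c v)] :
    childBox ident r q f v (ident c) = if IsChild r q c v then some (f c) else none := by
  rw [childBox, hid.extend_apply]
  congr

theorem childBox_eq_some (hid : Function.Injective ident) (f : V → ℕ) (v : V) (m y : ℕ) :
    childBox ident r q f v m = some y ↔ ∃ c, IsChild r q c v ∧ ident c = m ∧ f c = y := by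
  classical
  by_cases h : ∃ u, ident u = m
  · obtain ⟨c, rfl⟩ := h
    rw [childBox_ident hid]
    constructor
    · intro h
      split_ifs at h with hc
      exact ⟨c, hc, rfl, Option.some.inj h⟩
    · rintro ⟨c', hc', h1, h2⟩
      obtain rfl := hid h1
      rw [if_pos hc', h2]
  · rw [childBox, Function.extend_apply' _ _ _ h]
    simp only [reduceCtorEq, false_iff]
    rintro ⟨c, -, h1, -⟩
    exact h ⟨c, h1⟩

theorem childBox_ne_none (hid : Function.Injective ident) (f : V → ℕ) (v : V) (m : ℕ) :
    childBox ident r q f v m ≠ none ↔ ∃ c, IsChild r q c v ∧ ident c = m := by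
  rw [Option.ne_none_iff_exists']
  simp only [childBox_eq_some hid]
  constructor
  · rintro ⟨y, c, h1, h2, -⟩; exact ⟨c, h1, h2⟩
  · rintro ⟨c, h1, h2⟩; exact ⟨f c, c, h1, h2, rfl⟩

theorem childBox_congr {f g : V → ℕ} {v : V} (h : ∀ c, IsChild r q c v → f c = g c) :
    childBox ident r q f v = childBox ident r q g v := by
  classical
  unfold childBox
  congr 1
  funext c
  split_ifs with hc
  · rw [h c hc]
  · rfl

end Tree

section Network

variable {V : Type} [Fintype V] {G : SimpleGraph V} {ident : V → ℕ} {r : V} {q : V → V}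

theorem inbox_convStep (hid : Function.Injective ident) {get : Reg → ℕ}
    {upd : Finset ℕ → Reg → (ℕ → Option ℕ) → Reg} {j : ℕ} {s : V → Reg}
    (hs : IsTree G ident r q s) {v : V} (hv : G.dist r v = j) :
    inbox G ident (convStep get upd j) s v = childBox ident r q (fun c => get (s c)) v := by
  funext m
  apply Option.ext
  intro y
  rw [inbox_eq_some G hid, childBox_eq_some hid]
  refine exists_congr fun u => ?_
  simp only [convStep]
  constructor
  · rintro ⟨h1, h2, h3⟩
    split_ifs at h3 with h
    rw [hs.dep u] at h
    have hur : u ≠ r := by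
      rintro rfl
      simp at h
    rw [hs.par u hur] at h
    exact ⟨⟨hur, (hid h.2).symm⟩, h1, Option.some.inj h3⟩
  · rintro ⟨h1, h2, h3⟩
    have h4 := hs.bfsTree.dist_child h1
    refine ⟨h2, ?_, ?_⟩
    · rw [← h1.2]; exact (hs.adj u h1.1).symm
    · rw [if_pos ⟨by rw [hs.dep u, h4, hv], by rw [hs.par u h1.1, h1.2]⟩, h3]

theorem convs_succ (get : Reg → ℕ) (upd : Finset ℕ → Reg → (ℕ → Option ℕ) → Reg) (k : ℕ) :
    convs get upd (k + 1) = convStep get upd k :: convs get upd k := by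
  simp [convs, List.range_succ]

/-- A convergecast computes the recursion given by `upd`. -/
theorem convs_spec (hid : Function.Injective ident) {get : Reg → ℕ}
    {upd : Finset ℕ → Reg → (ℕ → Option ℕ) → Reg}
    (hupd : ∀ N s I, (upd N s I).dep = s.dep ∧ (upd N s I).par = s.par) (k : ℕ) (s : V → Reg)
    (hs : IsTree G ident r q s) :
    (∀ v, G.dist r v < k → exec G ident (convs get upd k) s v = upd (nbrIds G ident v) (s v)
      (childBox ident r q (fun c => get (exec G ident (convs get upd k) s c)) v)) ∧
    (∀ v, k ≤ G.dist r v → exec G ident (convs get upd k) s v = s v) ∧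
    (∀ u v, msgs G ident (convs get upd k) s u v = [] ∨ (0 < G.dist r u ∧ G.dist r u ≤ k) ∧
      msgs G ident (convs get upd k) s u v = [get (exec G ident (convs get upd k) s u)]) := by
  induction k generalizing s with
  | zero => simp [convs]
  | succ k ih =>
    rw [convs_succ, exec_cons]
    set s₁ := (convStep get upd k).app G ident s with hs₁
    have h1 : ∀ v, G.dist r v = k → s₁ v = upd (nbrIds G ident v) (s v)
        (childBox ident r q (fun c => get (s c)) v) := by
      intro v hv
      refine (if_pos ?_).trans ?_
      · rw [hs.dep v, hv]
      · rw [inbox_convStep hid hs hv]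
    have h2 : ∀ v, G.dist r v ≠ k → s₁ v = s v := by
      intro v hv
      refine if_neg ?_
      rw [hs.dep v]
      simpa using hv
    have hs₁' : IsTree G ident r q s₁ := hs.congr fun v => by
      by_cases hv : G.dist r v = k
      · rw [h1 v hv]; exact hupd _ _ _
      · rw [h2 v hv]; exact ⟨rfl, rfl⟩
    obtain ⟨i1, i2, i3⟩ := ih s₁ hs₁'
    refine ⟨?_, ?_, ?_⟩
    · intro v hv
      by_cases hv' : G.dist r v = k
      -- The level is processed once and its children are already final, so the update may be stated
      -- with the final registers of the children.
      · rw [i2 v hv'.ge, h1 v hv']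
        congr 1
        refine childBox_congr fun c hc => ?_
        have := hs.bfsTree.dist_child hc
        rw [i2 c (by omega), h2 c (by omega)]
      · rw [i1 v (by omega), h2 v hv']
    · intro v hv
      rw [i2 v (by omega), h2 v (by omega)]
    · intro u v
      rw [msgs_cons]
      by_cases hu : G.dist r u = k + 1
      · have h3 : msgs G ident (convs get upd k) s₁ u v = [] := by
          rcases i3 u v with h | h
          · exact h
          · omega
        rw [h3, i2 u (by omega), h2 u (by omega), List.append_nil]
        simp only [outgoing, convStep]
        split_ifs
        · exact Or.inr ⟨⟨by omega, by omega⟩, rfl⟩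
        · exact Or.inl rfl
        · exact Or.inl rfl
      · have : outgoing G ident (convStep get upd k) s u v = none := by
          simp [outgoing, convStep, hs.dep u, hu]
        rw [this]
        rcases i3 u v with h | ⟨h, h'⟩
        · exact Or.inl h
        · exact Or.inr ⟨⟨h.1, by omega⟩, h'⟩

theorem convs_msgBound (hid : Function.Injective ident) {get : Reg → ℕ}
    {upd : Finset ℕ → Reg → (ℕ → Option ℕ) → Reg}
    (hupd : ∀ N s I, (upd N s I).dep = s.dep ∧ (upd N s I).par = s.par) (k : ℕ) (s : V → Reg)
    (hs : IsTree G ident r q s) (Q : ℕ → Prop)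
    (hQ : ∀ v, v ≠ r → Q (get (exec G ident (convs get upd k) s v))) :
    MsgBound G ident (convs get upd k) s 1 Q := by
  intro u v
  rcases (convs_spec (get := get) hid hupd k s hs).2.2 u v with h | ⟨⟨hu, -⟩, h⟩
  · simp [h]
  · rw [h]
    refine ⟨le_rfl, fun m hm => ?_⟩
    rw [List.mem_singleton.1 hm]
    exact hQ u (by rintro rfl; simp at hu)

/-- The broadcast of labels. -/
theorem labels_spec (hid : Function.Injective ident) (k : ℕ) (s : V → Reg)
    (hs : IsTree G ident r q s) {f : V → ℕ} (hc : ∀ v, (s v).csz = childBox ident r q f v) :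
    (∀ v, exec G ident (labels k) s v =
      { s v with lab := (exec G ident (labels k) s v).lab }) ∧
    (∀ v, k < G.dist r v → exec G ident (labels k) s v = s v) ∧
    (exec G ident (labels k) s r).lab = (s r).lab ∧
    (∀ c x, IsChild r q c x → G.dist r c ≤ k → (exec G ident (labels k) s c).lab =
      childLabel (nbrIds G ident x) (exec G ident (labels k) s x) (ident c)) ∧
    (∀ u v, msgs G ident (labels k) s u v = [] ∨ (G.dist r u < k ∧ IsChild r q v u) ∧
      msgs G ident (labels k) s u v = [(exec G ident (labels k) s v).lab]) := by
  induction k with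
  | zero =>
    refine ⟨fun v => rfl, fun v _ => rfl, rfl, fun c x h1 h2 => ?_, fun u v => Or.inl rfl⟩
    have := hs.bfsTree.dist_child h1
    omega
  | succ k ih =>
    have he : exec G ident (labels (k + 1)) s =
        (labelStep k).app G ident (exec G ident (labels k) s) := by
      simp [labels, List.range_succ, exec_append]
    have hm : ∀ u v, msgs G ident (labels (k + 1)) s u v = msgs G ident (labels k) s u v ++
        (outgoing G ident (labelStep k) (exec G ident (labels k) s) u v).toList := by
      simp [labels, List.range_succ, msgs_append]
    rw [he]
    simp only [hm]
    obtain ⟨i1, i2, i3, i4, i5⟩ := ih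
    set s₁ := exec G ident (labels k) s with hs₁
    set s₂ := (labelStep k).app G ident s₁ with hs₂
    have hs₁' : IsTree G ident r q s₁ := hs.congr fun v => by rw [i1 v]; exact ⟨rfl, rfl⟩
    have hc₁ : ∀ v, (s₁ v).csz = childBox ident r q f v := fun v => by rw [i1 v]; exact hc v
    have hold : ∀ v, G.dist r v ≠ k + 1 → s₂ v = s₁ v := by
      intro v hv
      refine if_neg ?_
      rw [hs₁'.dep v]
      simpa using hv
    classical
    have hout : ∀ u v, outgoing G ident (labelStep k) s₁ u v = if IsChild r q v u ∧
        G.dist r u = k then some (childLabel (nbrIds G ident u) (s₁ u) (ident v)) else none := by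
      intro u v
      simp only [outgoing, labelStep, hs₁'.dep u, hc₁ u, childBox_ne_none hid, Option.some.injEq]
      by_cases h : IsChild r q v u ∧ G.dist r u = k
      · rw [if_pos h, if_pos, if_pos ⟨h.2, v, h.1, rfl⟩]
        rw [← h.1.2]
        exact hs.adj v h.1.1
      · rw [if_neg h]
        split_ifs with h1 h2
        · exfalso
          obtain ⟨h3, c, h4, h5⟩ := h2
          obtain rfl := hid h5
          exact h ⟨h4, h3⟩
        · rfl
        · rfl
    have hnew : ∀ c x, IsChild r q c x → G.dist r c = k + 1 → s₂ c =
        { s₁ c with lab := childLabel (nbrIds G ident x) (s₁ x) (ident c) } := by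
      intro c x h1 h2
      have h3 := hs.bfsTree.dist_child h1
      have hb : inbox G ident (labelStep k) s₁ c (s₁ c).par =
          some (childLabel (nbrIds G ident x) (s₁ x) (ident c)) := by
        rw [hs₁'.par c h1.1, h1.2, inbox_ident G hid, hout, if_pos ⟨h1, by omega⟩]
      refine (if_pos ?_).trans (congrArg (fun o => { s₁ c with lab := o.getD 0 }) hb)
      rw [hs₁'.dep c, h2]
    refine ⟨fun v => ?_, fun v hv => ?_, ?_, fun c x h1 h2 => ?_, fun u v => ?_⟩
    · by_cases hv : G.dist r v = k + 1
      · have hvr : v ≠ r := by rintro rfl; simp at hv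
        rw [hnew v (q v) ⟨hvr, rfl⟩ hv]
        conv_lhs => rw [i1 v]
      · rw [hold v hv]; exact i1 v
    · rw [hold v (by omega), i2 v (by omega)]
    · rw [hold r (by simp), i3]
    · have h3 := hs.bfsTree.dist_child h1
      rw [hold x (by omega)]
      by_cases hk : G.dist r c = k + 1
      · rw [hnew c x h1 hk]
      · rw [hold c hk, i4 c x h1 (by omega)]
    · rw [hout]
      by_cases h : IsChild r q v u ∧ G.dist r u = k
      · have h3 := hs.bfsTree.dist_child h.1
        have h4 : msgs G ident (labels k) s u v = [] := by
          rcases i5 u v with h' | h'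
          · exact h'
          · omega
        rw [if_pos h, h4, hnew v u h.1 (by omega)]
        exact Or.inr ⟨⟨h.2 ▸ Nat.lt_succ_self k, h.1⟩, rfl⟩
      · rw [if_neg h]
        simp only [Option.toList_none, List.append_nil]
        rcases i5 u v with h' | ⟨h1, h2⟩
        · exact Or.inl h'
        · right
          refine ⟨⟨Nat.lt_succ_of_lt h1.1, h1.2⟩, ?_⟩
          rw [h2]
          have h3 := hs.bfsTree.dist_child h1.2
          have h4 := h1.1
          rw [hold v (by omega)]

end Network

section Fold

variable {α : Type} {op : ℕ → ℕ → ℕ} [Std.Commutative op] [Std.Associative op]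
  {R : ℕ → ℕ → Prop} [Std.Refl R] [IsTrans ℕ R]

theorem fold_choice (hop : ∀ a b, op a b = a ∨ op a b = b) (s : Finset α) (b : ℕ) (f : α → ℕ) :
    s.fold op b f = b ∨ ∃ x ∈ s, s.fold op b f = f x := by
  classical
  induction s using Finset.induction_on with
  | empty => simp
  | insert a s ha ih =>
    rw [Finset.fold_insert ha]
    rcases hop (f a) (s.fold op b f) with h | h
    · exact Or.inr ⟨a, Finset.mem_insert_self a s, h⟩
    · rw [h]
      rcases ih with h | ⟨x, hx, h⟩
      · exact Or.inl h
      · exact Or.inr ⟨x, Finset.mem_insert_of_mem hx, h⟩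

theorem fold_rel (h₁ : ∀ a b, R (op a b) a) (h₂ : ∀ a b, R (op a b) b) (s : Finset α) (b : ℕ)
    (f : α → ℕ) : R (s.fold op b f) b ∧ ∀ x ∈ s, R (s.fold op b f) (f x) := by
  classical
  induction s using Finset.induction_on with
  | empty => exact ⟨refl _, by simp⟩
  | insert a s ha ih =>
    rw [Finset.fold_insert ha]
    refine ⟨_root_.trans (h₂ _ _) ih.1, fun x hx => ?_⟩
    rcases Finset.mem_insert.1 hx with rfl | hx
    · exact h₁ _ _
    · exact _root_.trans (h₂ _ _) (ih.2 x hx)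

end Fold

section Network

variable {V : Type} [Fintype V] {G : SimpleGraph V} {ident : V → ℕ} {r : V} {q : V → V}

theorem exists_of_mem_nbrIds {v : V} {m : ℕ} (h : m ∈ nbrIds G ident v) :
    ∃ u, G.Adj v u ∧ ident u = m := by
  simpa [nbrIds] using h

open Classical in
theorem sum_nbrIds (hid : Function.Injective ident) (T : BfsTree G r q) (f : V → ℕ) (v : V)
    (P : ℕ → Prop) : ∑ m ∈ nbrIds G ident v with P m, (childBox ident r q f v m).getD 0 =
      ∑ c with IsChild r q c v ∧ P (ident c), f c := by
  rw [Finset.sum_filter, nbrIds, Finset.sum_image fun _ _ _ _ h => hid h, Finset.sum_filter,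
    Finset.sum_filter]
  refine Finset.sum_congr rfl fun c _ => ?_
  rw [childBox_ident hid]
  by_cases h : IsChild r q c v
  · have : G.Adj v c := by
      rw [← h.2]; exact T.adj c h.1
    simp [h, this]
  · simp [h]

/-- The two rounds of aggregation compute extremal labels. -/
theorem extremal_of_fold (hid : Function.Injective ident) (T : BfsTree G r q) {op : ℕ → ℕ → ℕ}
    [Std.Commutative op] [Std.Associative op] {R : ℕ → ℕ → Prop} [Std.Refl R] [IsTrans ℕ R]
    (hop : ∀ a b, op a b = a ∨ op a b = b) (h₁ : ∀ a b, R (op a b) a) (h₂ : ∀ a b, R (op a b) b)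
    {lab f₁ f par : V → ℕ} (hpar : ∀ v, v ≠ r → par v = ident (q v)) {I : V → ℕ → Option ℕ}
    (hI : ∀ u v, G.Adj u v → I v (ident u) = some (lab u))
    (hf₁ : ∀ v, f₁ v = (nbrIds G ident v).fold op (lab v) fun m =>
      if m = par v then lab v else (I v m).getD (lab v))
    (hf : ∀ v, f v = (nbrIds G ident v).fold op (f₁ v) fun m =>
      (childBox ident r q f v m).getD (f₁ v)) :
    Extremal G r q R lab f := by
  classical
  constructor
  · intro v w hv hA hw
    have e1 := (fold_rel (R := R) h₁ h₂ (nbrIds G ident v) (f₁ v) fun m =>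
      (childBox ident r q f v m).getD (f₁ v)).1
    have e2 := (fold_rel (R := R) h₁ h₂ (nbrIds G ident v) (lab v) fun m =>
      if m = par v then lab v else (I v m).getD (lab v)).2 (ident w) ((mem_nbrIds G hid w v).2 hA)
    rw [← hf v] at e1
    rw [← hf₁ v, if_neg (by rw [hpar v hv]; exact fun h => hw (hid h)), hI w v hA.symm] at e2
    exact _root_.trans e1 e2
  · intro c x hc
    have hA : G.Adj x c := by rw [← hc.2]; exact T.adj c hc.1
    have e := (fold_rel (R := R) h₁ h₂ (nbrIds G ident x) (f₁ x) fun m =>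
      (childBox ident r q f x m).getD (f₁ x)).2 (ident c) ((mem_nbrIds G hid c x).2 hA)
    rwa [← hf x, childBox_ident hid, if_pos hc] at e
  · intro v hv
    have hfirst : f v = f₁ v → f v = lab v ∨ (∃ w, G.Adj v w ∧ w ≠ q v ∧ f v = lab w) ∨
        ∃ c, IsChild r q c v ∧ f v = f c := by
      intro h
      rw [h]
      rcases fold_choice hop (nbrIds G ident v) (lab v) fun m =>
        if m = par v then lab v else (I v m).getD (lab v) with e | ⟨m, hm, e⟩
      · left; rw [hf₁ v, e]
      · rw [← hf₁ v] at e
        split_ifs at e with hmp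
        · exact Or.inl e
        · obtain ⟨w, hw, rfl⟩ := exists_of_mem_nbrIds hm
          rw [hI w v hw.symm] at e
          refine Or.inr (Or.inl ⟨w, hw, ?_, e⟩)
          rintro rfl
          exact hmp (hpar v hv).symm
    rcases fold_choice hop (nbrIds G ident v) (f₁ v) fun m =>
      (childBox ident r q f v m).getD (f₁ v) with e | ⟨m, hm, e⟩
    · exact hfirst (by rw [hf v, e])
    · rw [← hf v] at e
      obtain ⟨w, hw, rfl⟩ := exists_of_mem_nbrIds hm
      rw [childBox_ident hid] at e
      split_ifs at e with hc
      · exact Or.inr (Or.inr ⟨w, hc, e⟩)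
      · exact hfirst e

variable (G ident r q) in
/-- The registers between two phases, where unfinished classes have at least `N` elements. -/
structure PhaseInv (N : ℕ) (s : V → Reg) : Prop where
  tree : IsTree G ident r q s
  size : ∀ x, (s x).sz = 1 + (open Classical in ∑ c with IsChild r q c x, (s c).sz)
  csz : ∀ x, (s x).csz = childBox ident r q (fun c => (s c).sz) x
  root : (s r).lab = 0
  init : ∀ x a b, InitLink ident r q x a b → (s x).link a b
  sound : ∀ x z, IsBase ident r q x z → SoundLink G ident x z (s x).link
  bound : ∀ x, (∀ u w, u ≠ x → w ≠ x → ConnAvoiding G x u w) →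
    ClassBound ident r q x (s x).link N

theorem sizes_spec (hid : Function.Injective ident) (hG : G.Connected) {d : ℕ} {s : V → Reg}
    (hs : IsTree G ident r q s) (hd : ∀ v, G.dist r v ≤ d) :
    PhaseInv G ident r q 1 (exec G ident (convs Reg.sz sizeUpd (d + 1)) s) ∧
    MsgBound G ident (convs Reg.sz sizeUpd (d + 1)) s 1
      (fun m => m < (Fintype.card V + 1) ^ 2) := by
  classical
  have hupd : ∀ N s I, (sizeUpd N s I).dep = s.dep ∧ (sizeUpd N s I).par = s.par :=
    fun _ _ _ => ⟨rfl, rfl⟩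
  have hex := fun v => (convs_spec (get := Reg.sz) hid hupd (d + 1) s hs).1 v
    (Nat.lt_succ_of_le (hd v))
  set s' := exec G ident (convs Reg.sz sizeUpd (d + 1)) s with hs'
  have htree : IsTree G ident r q s' := hs.congr fun v => by rw [hex v]; exact hupd _ _ _
  have hsize : ∀ x, (s' x).sz = 1 + ∑ c with IsChild r q c x, (s' c).sz := by
    intro x
    have := sum_nbrIds hid hs.bfsTree (fun c => (s' c).sz) x (fun _ => True)
    simp only [Finset.filter_true, and_true] at this
    rw [hex x, ← this]
    rfl
  have hlink : ∀ x a b, (s' x).link a b ↔ InitLink ident r q x a b := by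
    intro x a b
    rw [hex x]
    simp only [sizeUpd, InitLink, childBox_ne_none hid, hs.dep x, Option.some.injEq]
    have hx : G.dist r x = 0 ↔ x = r := by
      rw [hG.dist_eq_zero_iff, eq_comm]
    rw [hx]
    refine and_congr_right fun _ => and_congr_right fun _ => ?_
    constructor
    · rintro ⟨m, rfl, ⟨c, hc, rfl⟩, hmin⟩
      exact ⟨c, hc, rfl, fun c' hc' => hmin _ ⟨c', hc', rfl⟩⟩
    · rintro ⟨c, hc, rfl, hmin⟩
      exact ⟨_, rfl, ⟨c, hc, rfl⟩, by rintro _ ⟨c', hc', rfl⟩; exact hmin c' hc'⟩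
  refine ⟨⟨htree, hsize, fun x => ?_, ?_, fun x a b => (hlink x a b).2, fun x z hz a b h => ?_,
    fun x _ => classBound_one x _⟩, ?_⟩
  · conv_lhs => rw [hex x]
    rfl
  · rw [hex r]; rfl
  · exact soundLink_init hid hz a b ((hlink x a b).1 h)
  · refine convs_msgBound hid hupd _ s hs _ fun v _ => ?_
    have h1 : (s' v).sz ≤ Fintype.card V := by
      rw [subtree_card hs.bfsTree (fun x => (s' x).sz) hsize v]
      exact Finset.card_le_univ _
    have : (s' v).sz < Fintype.card V + 1 := by omega
    exact this.trans_le (Nat.le_self_pow (by norm_num) _)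

/-- The broadcast and `linkUpd` both order the children by the links known before the phase, so the
intervals that a vertex recomputes for its children are those actually assigned. The three messages
are a label from the parent, the exchanged label and the pair of extremal labels. -/
theorem phase_spec (hid : Function.Injective ident) (hG : G.Connected) {d : ℕ} {s : V → Reg}
    {N : ℕ} (hs : PhaseInv G ident r q N s) (hd : ∀ v, G.dist r v ≤ d) :
    PhaseInv G ident r q (2 * N) (exec G ident (phase d) s) ∧
    MsgBound G ident (phase d) s 3 (fun m => m < (Fintype.card V + 1) ^ 2) := by
  classical
  have T := hs.tree.bfsTree
  obtain ⟨l1, -, l3, l4, l5⟩ := labels_spec hid d s hs.tree hs.csz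
  have hexec : exec G ident (phase d) s = exec G ident (convs (fun s => Nat.pair s.lo s.hi)
      linkUpd (d + 1)) (exchangeStep.app G ident (exec G ident (labels d) s)) := by
    rw [phase, exec_append, exec_cons]
  set s₁ := exec G ident (labels d) s with hs₁
  set s₂ := exchangeStep.app G ident s₁ with hs₂
  have hupd : ∀ N s I, (linkUpd N s I).dep = s.dep ∧ (linkUpd N s I).par = s.par :=
    fun _ _ _ => ⟨rfl, rfl⟩
  have ht₁ : IsTree G ident r q s₁ := hs.tree.congr fun v => by rw [l1 v]; exact ⟨rfl, rfl⟩
  have ht₂ : IsTree G ident r q s₂ := ht₁.congr fun v => ⟨rfl, rfl⟩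
  have hex := fun v => (convs_spec (get := fun s => Nat.pair s.lo s.hi) hid hupd (d + 1) s₂
    ht₂).1 v (Nat.lt_succ_of_le (hd v))
  set s₃ := exec G ident (convs (fun s => Nat.pair s.lo s.hi) linkUpd (d + 1)) s₂ with hs₃
  have hlab : ∀ v, (s₃ v).lab = (s₁ v).lab := fun v => by rw [hex v]; rfl
  have hsz₁ : ∀ v, (s₁ v).sz = (s v).sz := fun v => by rw [l1 v]
  have hcsz₁ : ∀ v, (s₁ v).csz = (s v).csz := fun v => by rw [l1 v]
  have hlink₁ : ∀ v, (s₁ v).link = (s v).link := fun v => by rw [l1 v]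
  have hsz₃ : ∀ v, (s₃ v).sz = (s v).sz := fun v => by rw [hex v]; exact hsz₁ v
  have hcsz₃ : ∀ v, (s₃ v).csz = (s v).csz := fun v => by rw [hex v]; exact hcsz₁ v
  have ht₃ : IsTree G ident r q s₃ := ht₂.congr fun v => by rw [hex v]; exact hupd _ _ _
  have A : Labelling r q (fun x c => childKey (s x).link (ident c)) (fun v => (s v).sz)
      (fun v => (s₁ v).lab) := by
    refine ⟨fun x c c' h => hid (childKey_injective _ h), ?_, l3.trans hs.root, fun c x hc => ?_⟩
    · intro x
      rw [hs.size x]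
    · have := sum_nbrIds hid T (fun c => (s c).sz) x
        fun m => childKey (s x).link m < childKey (s x).link (ident c)
      rw [l4 c x hc (hd c), childLabel, hcsz₁, hlink₁, hs.csz]
      convert congrArg (fun n => (s₁ x).lab + 1 + n) this
  have hI : ∀ u v, G.Adj u v → inbox G ident exchangeStep s₁ v (ident u) = some (s₁ u).lab := by
    intro u v hA
    rw [inbox_ident G hid, outgoing, if_pos hA]
    simp [exchangeStep, ht₁.dep u]
  have hmap : ∀ (φ : ℕ → ℕ) v m, (childBox ident r q (fun c => Nat.pair (s₃ c).lo (s₃ c).hi) v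
      m).map φ = childBox ident r q (fun c => φ (Nat.pair (s₃ c).lo (s₃ c).hi)) v m := by
    intro φ v m
    rw [childBox, childBox, extend_map hid]
    congr 1
    funext c
    split_ifs <;> rfl
  have E : Extremal G r q (· ≤ ·) (fun v => (s₁ v).lab) (fun v => (s₃ v).lo) := by
    refine extremal_of_fold hid T (op := min) (fun a b => min_choice a b) min_le_left min_le_right
      (fun v hv => ht₁.par v hv) hI (f₁ := fun v => (s₂ v).lo) (fun v => ?_) (fun v => ?_)
    · rfl
    · conv_lhs => rw [hex v]
      simp only [linkUpd, hmap, Nat.unpair_pair]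
  have E' : Extremal G r q (· ≥ ·) (fun v => (s₁ v).lab) (fun v => (s₃ v).hi) := by
    refine extremal_of_fold hid T (op := max) (fun a b => max_choice a b) le_max_left le_max_right
      (fun v hv => ht₁.par v hv) hI (f₁ := fun v => (s₂ v).hi) (fun v => ?_) (fun v => ?_)
    · rfl
    · conv_lhs => rw [hex v]
      simp only [linkUpd, hmap, Nat.unpair_pair]
  have hpart : ∀ x l b, InPartLocal (nbrIds G ident x) (s₂ x) l b ↔
      InPart ident r q (fun v => (s v).sz) (fun v => (s₁ v).lab) x l b := by
    intro x l b
    have e1 : (s₂ x).csz = childBox ident r q (fun c => (s c).sz) x := (hcsz₁ x).trans (hs.csz x)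
    have e2 : (s₂ x).sz = (s x).sz := hsz₁ x
    have e3 : ∀ m, childLabel (nbrIds G ident x) (s₂ x) m =
      childLabel (nbrIds G ident x) (s₁ x) m := fun m => rfl
    cases b with
    | none =>
      simp only [InPartLocal, InPart, e2]
      rfl
    | some m =>
      simp only [InPartLocal, InPart, e1, childBox_eq_some hid, e3]
      constructor
      · rintro ⟨z, ⟨c, hc, rfl, rfl⟩, h⟩
        rw [← l4 c x hc (hd c)] at h
        exact ⟨c, hc, rfl, h⟩
      · rintro ⟨c, hc, rfl, h⟩
        rw [l4 c x hc (hd c)] at h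
        exact ⟨_, ⟨c, hc, rfl, rfl⟩, h⟩
  have hlink₃ : ∀ x, (s₃ x).link = NewLink ident r q (fun v => (s v).sz) (fun v => (s₁ v).lab)
      (fun v => (s₃ v).lo) (fun v => (s₃ v).hi) x (s x).link := by
    intro x
    funext a b
    have e : (s₂ x).link = (s x).link := hlink₁ x
    conv_lhs => rw [hex x]
    simp only [linkUpd, NewLink, e, hpart, childBox_eq_some hid, eq_iff_iff]
    refine or_congr_right ?_
    constructor
    · rintro ⟨m, y, ⟨c, hc, rfl, rfl⟩, rfl, h⟩
      exact ⟨c, hc, rfl, by simpa using h⟩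
    · rintro ⟨c, hc, rfl, h⟩
      exact ⟨_, _, ⟨c, hc, rfl, rfl⟩, rfl, by simpa using h⟩
  have hlt : ∀ v, (s₁ v).lab < Fintype.card V := fun v => A.lt_card T v
  have hQ : ∀ v, (s₁ v).lab < (Fintype.card V + 1) ^ 2 := fun v =>
    ((hlt v).trans (Nat.lt_succ_self _)).trans_le (Nat.le_self_pow (by norm_num) _)
  rw [hexec]
  refine ⟨⟨ht₃, fun x => ?_, fun x => ?_, ?_, fun x a b h => ?_, fun x z hz => ?_,
    fun x hx => ?_⟩, ?_⟩
  · simp only [hsz₃]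
    exact hs.size x
  · simp only [hsz₃, hcsz₃]
    exact hs.csz x
  · rw [hlab, l3, hs.root]
  · rw [hlink₃]
    exact Or.inl (hs.init x a b h)
  · rw [hlink₃]
    exact (hs.sound x z hz).newLink hG T A E E' hz
  · rw [hlink₃]
    exact (hs.bound x hx).newLink hG T A E E' (hs.init x) hx
  · have m1 : MsgBound G ident (labels d) s 1 (fun m => m < (Fintype.card V + 1) ^ 2) := by
      intro u v
      rcases l5 u v with h | ⟨-, h⟩
      · simp [h]
      · rw [h]
        exact ⟨le_rfl, fun m hm => by rw [List.mem_singleton.1 hm]; exact hQ v⟩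
    have m2 : MsgBound G ident [exchangeStep] s₁ 1 (fun m => m < (Fintype.card V + 1) ^ 2) := by
      refine msgBound_single _ _ _ fun u m x hx => ?_
      simp only [exchangeStep, ht₁.dep u, reduceCtorEq, if_false, Option.some.injEq] at hx
      rw [← hx]
      exact hQ u
    have m3 := convs_msgBound (get := fun s => Nat.pair s.lo s.hi) hid hupd (d + 1) s₂ ht₂
      (fun m => m < (Fintype.card V + 1) ^ 2) fun v hv => by
        obtain ⟨_, w, -, h1, -⟩ := E.exists_below T v hv
        obtain ⟨_, w', -, h2, -⟩ := E'.exists_below T v hv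
        -- Both extremal values are labels of vertices, hence less than `n`; the root sends no
        -- report, so its registers do not matter.
        refine (Nat.pair_lt_max_add_one_sq _ _).trans_le (Nat.pow_le_pow_left ?_ 2)
        have h3 : (s₃ v).lo < Fintype.card V := h1 ▸ hlt w
        have h4 : (s₃ v).hi < Fintype.card V := h2 ▸ hlt w'
        exact Nat.succ_le_succ (max_lt h3 h4).le
    exact (m1.append (m2.append m3)).mono (by omega) fun _ h => h

theorem treeWork_spec (hid : Function.Injective ident) (hG : G.Connected) {d : ℕ} (L : ℕ)
    {s : V → Reg} (hs : IsTree G ident r q s) (hd : ∀ v, G.dist r v ≤ d) :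
    PhaseInv G ident r q (2 ^ L) (exec G ident (treeWork d L) s) ∧
    MsgBound G ident (treeWork d L) s (1 + 3 * L) (fun m => m < (Fintype.card V + 1) ^ 2) := by
  obtain ⟨h1, h2⟩ := sizes_spec hid hG hs hd
  rw [treeWork, exec_append]
  set s' := exec G ident (convs Reg.sz sizeUpd (d + 1)) s with hs'
  suffices h : PhaseInv G ident r q (2 ^ L)
      (exec G ident ((List.range L).flatMap fun _ => phase d) s') ∧
      MsgBound G ident ((List.range L).flatMap fun _ => phase d) s' (3 * L)
        (fun m => m < (Fintype.card V + 1) ^ 2) from ⟨h.1, h2.append h.2⟩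
  induction L with
  | zero => exact ⟨by simpa using h1, MsgBound.nil⟩
  | succ L ih =>
    obtain ⟨i1, i2⟩ := ih
    obtain ⟨j1, j2⟩ := phase_spec hid hG i1 hd
    simp only [List.range_succ, List.flatMap_append, List.flatMap_cons, List.flatMap_nil,
      List.append_nil, exec_append]
    rw [pow_succ, mul_comm]
    exact ⟨j1, (i2.append j2).mono (by omega) fun _ h => h⟩

theorem verdict_eq (hid : Function.Injective ident) {N : ℕ} {s : V → Reg}
    (hs : PhaseInv G ident r q N s) (hN : Fintype.card V ≤ N) (v : V) :
    ∃ b, verdict (s v) = some b ∧ (b = true ↔ IsCutVertex G v) := by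
  classical
  obtain ⟨z, hz⟩ := exists_isBase ident r q v
  have hv : verdict (s v) = _ := if_neg (by rw [hs.tree.dep v]; simp)
  refine ⟨_, hv, ?_⟩
  rw [isCutVertex_iff_link hid hs.tree.bfsTree hz (hs.sound v z hz) hN (hs.bound v),
    decide_eq_true_iff, hs.csz v]
  simp only [childBox_ne_none hid]
  constructor
  · rintro ⟨m, ⟨c, hc, rfl⟩, h⟩; exact ⟨c, hc, h⟩
  · rintro ⟨c, hc, h⟩; exact ⟨_, ⟨c, hc, rfl⟩, h⟩

end Network

/-! ### A single trial with guessed parameters -/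

/-- One attempt with waves of `d` rounds and identifiers of `L` bits, before the output. -/
noncomputable def attemptWork (d L : ℕ) : List (Step Reg) := setup d L ++ treeWork d L

/-- One attempt with waves of `d` rounds and identifiers of `L` bits. -/
noncomputable def attempt (d L : ℕ) : List (Step Reg) := attemptWork d L ++ [finishStep]

/-- The steps do not change the output. -/
def KeepsOut (l : List (Step Reg)) : Prop :=
  ∀ st ∈ l, ∀ i N s I, (st.recv i N s I).out = s.out

/-- The steps do nothing in nodes without a tree. -/
def Quiet (l : List (Step Reg)) : Prop :=
  ∀ st ∈ l, ∀ i N s, s.dep = none → (∀ m, st.send i N s m = none) ∧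
    ∀ I, (st.recv i N s I).dep = none

theorem keepsOut_append {l₁ l₂ : List (Step Reg)} :
    KeepsOut (l₁ ++ l₂) ↔ KeepsOut l₁ ∧ KeepsOut l₂ := List.forall_mem_append

theorem keepsOut_cons {st : Step Reg} {l : List (Step Reg)} :
    KeepsOut (st :: l) ↔ (∀ i N s I, (st.recv i N s I).out = s.out) ∧ KeepsOut l :=
  List.forall_mem_cons

theorem keepsOut_nil : KeepsOut [] := by simp [KeepsOut]

theorem KeepsOut.flatMap {α : Type} {l : List α} {f : α → List (Step Reg)}
    (h : ∀ a, KeepsOut (f a)) : KeepsOut (l.flatMap f) := by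
  intro st hst
  obtain ⟨a, -, ha⟩ := List.mem_flatMap.1 hst
  exact h a st ha

theorem keepsOut_waves (k : ℕ) : KeepsOut (waves k) := by
  intro st hst i N s I
  obtain ⟨j, -, rfl⟩ := List.mem_map.1 hst
  simp only [waveStep]
  split_ifs <;> rfl

theorem keepsOut_labels (k : ℕ) : KeepsOut (labels k) := by
  intro st hst i N s I
  obtain ⟨j, -, rfl⟩ := List.mem_map.1 hst
  simp only [labelStep]
  split_ifs <;> rfl

theorem keepsOut_convs {get : Reg → ℕ} {upd : Finset ℕ → Reg → (ℕ → Option ℕ) → Reg}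
    (h : ∀ N s I, (upd N s I).out = s.out) (k : ℕ) : KeepsOut (convs get upd k) := by
  intro st hst i N s I
  obtain ⟨j, -, rfl⟩ := List.mem_map.1 hst
  simp only [convStep]
  split_ifs
  · exact h _ _ _
  · rfl

theorem keepsOut_attemptWork (d L : ℕ) : KeepsOut (attemptWork d L) := by
  have hb : ∀ i, KeepsOut (electBit d i) := fun i =>
    keepsOut_append.2 ⟨keepsOut_cons.2 ⟨fun _ _ _ _ => rfl, keepsOut_waves d⟩,
      keepsOut_cons.2 ⟨fun _ _ _ _ => rfl, keepsOut_nil⟩⟩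
  have he : KeepsOut (elect d L) := keepsOut_cons.2 ⟨fun _ _ _ _ => rfl, .flatMap hb⟩
  have hs : KeepsOut (setup d L) := keepsOut_append.2 ⟨he, keepsOut_append.2
    ⟨keepsOut_cons.2 ⟨fun _ _ _ _ => rfl, keepsOut_waves d⟩, keepsOut_append.2
      ⟨keepsOut_cons.2 ⟨fun _ _ _ _ => rfl, keepsOut_waves _⟩,
        keepsOut_cons.2 ⟨fun _ _ _ _ => rfl, keepsOut_nil⟩⟩⟩⟩
  have hp : KeepsOut (phase d) := keepsOut_append.2 ⟨keepsOut_labels d,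
    keepsOut_cons.2 ⟨fun _ _ _ _ => rfl, keepsOut_convs (upd := linkUpd) (fun _ _ _ => rfl) _⟩⟩
  exact keepsOut_append.2 ⟨hs, keepsOut_append.2
    ⟨keepsOut_convs (upd := sizeUpd) (fun _ _ _ => rfl) _,
    .flatMap fun _ => hp⟩⟩

theorem quiet_convs {get : Reg → ℕ} {upd : Finset ℕ → Reg → (ℕ → Option ℕ) → Reg} (k : ℕ) :
    Quiet (convs get upd k) := by
  intro st hst i N s hs
  obtain ⟨j, -, rfl⟩ := List.mem_map.1 hst
  simp [convStep, hs]

theorem quiet_phase (d : ℕ) : Quiet (phase d) := by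
  refine List.forall_mem_append.2 ⟨?_, List.forall_mem_cons.2 ⟨?_, quiet_convs _⟩⟩
  · intro st hst i N s hs
    obtain ⟨j, -, rfl⟩ := List.mem_map.1 hst
    simp [labelStep, hs]
  · intro i N s hs
    simp [exchangeStep, hs]

theorem quiet_treeWork (d L : ℕ) : Quiet (treeWork d L) := by
  refine List.forall_mem_append.2 ⟨quiet_convs _, fun st hst => ?_⟩
  obtain ⟨a, -, ha⟩ := List.mem_flatMap.1 hst
  exact quiet_phase d st ha

section Network

variable {V : Type} [Fintype V] {G : SimpleGraph V} {ident : V → ℕ}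

theorem KeepsOut.exec {l : List (Step Reg)} (h : KeepsOut l) (s : V → Reg) (v : V) :
    (exec G ident l s v).out = (s v).out := by
  induction l generalizing s with
  | nil => rfl
  | cons st l ih =>
    rw [keepsOut_cons] at h
    rw [exec_cons, ih h.2]
    exact h.1 _ _ _ _

theorem Quiet.exec {l : List (Step Reg)} (h : Quiet l) (s : V → Reg) (hs : ∀ v, (s v).dep = none) :
    (∀ v, (exec G ident l s v).dep = none) ∧ ∀ Q, MsgBound G ident l s 0 Q := by
  induction l generalizing s with
  | nil => exact ⟨hs, fun Q => MsgBound.nil⟩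
  | cons st l ih =>
    have h' := List.forall_mem_cons.1 h
    have := ih h'.2 (st.app G ident s) fun v => (h'.1 _ _ _ (hs v)).2 _
    exact ⟨this.1, fun Q => (msgBound_silent st s (fun u m => (h'.1 _ _ _ (hs u)).1 m) Q).append
      (this.2 Q)⟩

theorem size_le_of_lt_sq {n m : ℕ} (h : m < (n + 1) ^ 2) : m.size ≤ 2 * (Nat.log 2 n + 1) := by
  rw [Nat.size_le, mul_comm, pow_mul]
  exact h.trans_le (Nat.pow_le_pow_left (Nat.lt_pow_succ_log_self (by norm_num) n) 2)

/-- This turns the check on identifier lengths into the guarantee that `L` doublings exceed every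
possible class. -/
theorem card_le_of_size_le (hid : Function.Injective ident) {L : ℕ}
    (h : ∀ v, (ident v).size ≤ L) : Fintype.card V ≤ 2 ^ L := by
  have : Function.Injective fun v => (⟨ident v, Nat.size_le.1 (h v)⟩ : Fin (2 ^ L)) :=
    fun u v huv => hid (congrArg Fin.val huv)
  simpa using Fintype.card_le_of_injective _ this

/-- An attempt fails in all vertices, or all vertices produce the correct output. -/
theorem attempt_spec (hid : Function.Injective ident) (hG : G.Connected) {S B : ℕ}
    (hS : ∀ v, (ident v).size ≤ S) (hSB : S ≤ B) (hB : 2 * (Nat.log 2 (Fintype.card V) + 1) ≤ B)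
    (d L : ℕ) (s : V → Reg) :
    ((∀ v, (exec G ident (attempt d L) s v).out = none) ∧ ¬ (G.diam ≤ d ∧ S ≤ L) ∧
      MsgBound G ident (attempt d L) s (S + 3) fun m => m.size ≤ B) ∨
    ((∀ v, ∃ b, (exec G ident (attempt d L) s v).out = some b ∧ (b = true ↔ IsCutVertex G v)) ∧
      G.diam ≤ 2 * d ∧
      MsgBound G ident (attempt d L) s (S + 4 + 3 * L) fun m => m.size ≤ B) := by
  have hne := hG.nonempty
  have hout : ∀ v, (exec G ident (attempt d L) s v).out =
      verdict (exec G ident (treeWork d L) (exec G ident (setup d L) s) v) := by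
    intro v
    rw [attempt, attemptWork, exec_append, exec_append]
    rfl
  have hm : MsgBound G ident (setup d L) s (S + 3) fun m => m.size ≤ B :=
    (setup_msgBound G hid d L S hS s).mono le_rfl fun m h => h.trans hSB
  rcases setup_spec G hid hG d L s with ⟨h1, h2⟩ | ⟨h1, r, q, h2, h3⟩
  · left
    obtain ⟨q1, q2⟩ := (quiet_treeWork d L).exec (G := G) (ident := ident) _ h1
    refine ⟨fun v => ?_, fun h => h2 ⟨h.1, fun v => (hS v).trans h.2⟩, ?_⟩
    · rw [hout, verdict, if_pos (q1 v)]
    -- Without a tree the remaining rounds are silent, so the cost of failure does not depend on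
    -- `L`.
    · exact (hm.append (q2 _)).append (localStep_msgBound G _ _ _)
  · right
    obtain ⟨t1, t2⟩ := treeWork_spec hid hG L h2 h3
    refine ⟨fun v => ?_, ?_, ?_⟩
    · rw [hout]
      exact verdict_eq hid t1 (card_le_of_size_le hid h1) v
    -- Any two vertices are within `d` of the root, hence within `2 * d` of each other.
    · obtain ⟨u, v, huv⟩ := G.exists_dist_eq_diam
      rw [← huv]
      refine (hG.dist_triangle (u := u) (v := r) (w := v)).trans ?_
      have e1 := h3 u
      have e2 := h3 v
      rw [SimpleGraph.dist_comm] at e1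
      omega
    · exact ((hm.append (t2.mono le_rfl fun m h => (size_le_of_lt_sq h).trans hB)).append
        (localStep_msgBound G _ _ _)).mono (by omega) fun _ h => h

theorem attempt_out (d L : ℕ) (s : V → Reg) (hs : ∀ v, (s v).out = none) (t : ℕ)
    (ht : t < (attempt d L).length) (v : V) :
    (exec G ident ((attempt d L).take t) s v).out = none := by
  rw [attempt, List.length_append, List.length_singleton] at ht
  rw [attempt, List.take_append_of_le_length (by omega), KeepsOut.exec, hs]
  exact fun st hst => keepsOut_attemptWork d L st (List.mem_of_mem_take hst)

/-- A list of attempts contains a first successful one. -/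
theorem exists_first_success (hid : Function.Injective ident) (hG : G.Connected) {S B : ℕ}
    (hS : ∀ v, (ident v).size ≤ S) (hSB : S ≤ B) (hB : 2 * (Nat.log 2 (Fintype.card V) + 1) ≤ B)
    (ps : List (ℕ × ℕ)) (hps : ∃ p ∈ ps, G.diam ≤ p.1 ∧ S ≤ p.2) (s : V → Reg)
    (hs : ∀ v, (s v).out = none) :
    ∃ l₁ p l₂, ps = (l₁ ++ [p]) ++ l₂ ∧ G.diam ≤ 2 * p.1 ∧
      ∃ F, F = (l₁ ++ [p]).flatMap (fun p => attempt p.1 p.2) ∧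
      (∀ t < F.length, ∀ v, (exec G ident (F.take t) s v).out = none) ∧
      (∀ v, ∃ b, (exec G ident F s v).out = some b ∧ (b = true ↔ IsCutVertex G v)) ∧
      MsgBound G ident F s (l₁.length * (S + 3) + (S + 4 + 3 * p.2)) fun m => m.size ≤ B := by
  induction ps generalizing s with
  | nil => simp at hps
  | cons p ps ih =>
    rcases attempt_spec hid hG hS hSB hB p.1 p.2 s with ⟨h1, h2, h3⟩ | ⟨h1, h2, h3⟩
    · have hps' : ∃ p ∈ ps, G.diam ≤ p.1 ∧ S ≤ p.2 := by
        obtain ⟨p', hp', h⟩ := hps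
        rcases List.mem_cons.1 hp' with rfl | hp'
        · exact absurd h h2
        · exact ⟨p', hp', h⟩
      obtain ⟨l₁, p', l₂, e1, e2, F, rfl, e3, e4, e5⟩ := ih hps' _ h1
      refine ⟨p :: l₁, p', l₂, by simp [e1], e2, _, rfl, ?_, ?_, ?_⟩
      · intro t ht v
        rw [List.cons_append, List.flatMap_cons] at ht ⊢
        rw [List.take_append, exec_append]
        rcases lt_or_ge t (attempt p.1 p.2).length with h | h
        · rw [Nat.sub_eq_zero_of_le h.le, List.take_zero, exec_nil]
          exact attempt_out p.1 p.2 s hs t h v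
        · rw [List.take_of_length_le h]
          refine e3 _ ?_ v
          rw [List.length_append] at ht
          omega
      · intro v
        rw [List.cons_append, List.flatMap_cons, exec_append]
        exact e4 v
      · rw [List.cons_append, List.flatMap_cons]
        refine (h3.append e5).mono (le_of_eq ?_) fun _ h => h
        rw [List.length_cons]
        ring
    · refine ⟨[], p, ps, rfl, h2, attempt p.1 p.2, by simp, ?_, h1, ?_⟩
      · exact attempt_out p.1 p.2 s hs
      · simpa using h3

end Network

/-! ### The schedule of trials -/

/-- The parameters of the attempts in the first `k` groups. -/
def params (k : ℕ) : List (ℕ × ℕ) :=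
  -- Group `j` runs through all pairs of powers of two with product `2 ^ j`, so all its trials take
  -- `O(2 ^ j)` rounds.
  (List.range k).flatMap fun j => (List.range (j + 1)).map fun l => (2 ^ (j - l), 2 ^ l)

/-- The first `k` groups of attempts. -/
noncomputable def schedule (k : ℕ) : List (Step Reg) :=
  (params k).flatMap fun p => attempt p.1 p.2

/-- The infinite sequence of rounds. -/
noncomputable def rounds (t : ℕ) : Step Reg := ((schedule (t + 1))[t]?).getD finishStep

theorem params_succ (k : ℕ) : params (k + 1) =
    params k ++ (List.range (k + 1)).map fun l => (2 ^ (k - l), 2 ^ l) := by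
  simp [params, List.range_succ]

theorem length_params (k : ℕ) : (params k).length ≤ k ^ 2 := by
  induction k with
  | zero => simp [params]
  | succ k ih =>
    rw [params_succ, List.length_append, List.length_map, List.length_range]
    nlinarith

theorem mem_params {k : ℕ} {p : ℕ × ℕ} (h : p ∈ params (k + 1)) :
    1 ≤ p.1 ∧ 1 ≤ p.2 ∧ p.1 * p.2 ≤ 2 ^ k := by
  simp only [params, List.mem_flatMap, List.mem_range, List.mem_map] at h
  obtain ⟨j, hj, l, hl, rfl⟩ := h
  refine ⟨Nat.one_le_two_pow, Nat.one_le_two_pow, ?_⟩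
  rw [← pow_add]
  exact Nat.pow_le_pow_right (by norm_num) (by omega)

theorem schedule_succ (k : ℕ) : schedule (k + 1) = schedule k ++
    ((List.range (k + 1)).map fun l => (2 ^ (k - l), 2 ^ l)).flatMap
      fun p : ℕ × ℕ => attempt p.1 p.2 := by
  rw [schedule, params_succ, List.flatMap_append, schedule]

theorem schedule_prefix {k k' : ℕ} (h : k ≤ k') : schedule k <+: schedule k' := by
  induction k', h using Nat.le_induction with
  | base => exact List.prefix_rfl
  | succ k' _ ih => exact ih.trans (schedule_succ k' ▸ List.prefix_append _ _)

theorem le_length_schedule (k : ℕ) : k ≤ (schedule k).length := by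
  induction k with
  | zero => simp
  | succ k ih =>
    rw [schedule_succ, List.length_append, List.range_succ, List.map_append, List.flatMap_append,
      List.length_append]
    simp [attempt]
    omega

/-- The schedules are prefixes of one another, and `schedule (t + 1)` has more than `t` rounds, so
the default value in `rounds` is never used. -/
theorem getElem?_schedule {k t : ℕ} (h : t < (schedule k).length) :
    (schedule k)[t]? = some (rounds t) := by
  have key : ∀ {l₁ l₂ : List (Step Reg)}, l₁ <+: l₂ → t < l₁.length → l₂[t]? = l₁[t]? := by
    rintro l₁ _ ⟨l, rfl⟩ h
    exact List.getElem?_append_left h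
  have ht : t < (schedule (t + 1)).length := le_length_schedule (t + 1)
  have : (schedule k)[t]? = (schedule (t + 1))[t]? := by
    rcases le_total k (t + 1) with h' | h'
    · exact (key (schedule_prefix h') h).symm
    · exact key (schedule_prefix h') ht
  rw [rounds, this, List.getElem?_eq_getElem ht, Option.getD_some]

theorem map_rounds {k : ℕ} {F : List (Step Reg)} (hF : F <+: schedule k) {t : ℕ}
    (ht : t ≤ F.length) : (List.range t).map rounds = F.take t := by
  refine List.ext_getElem? fun i => ?_
  by_cases hi : i < t
  · obtain ⟨l, hl⟩ := hF
    have h1 : (schedule k)[i]? = some (rounds i) :=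
      getElem?_schedule (by rw [← hl, List.length_append]; omega)
    rw [← hl, List.getElem?_append_left (by omega)] at h1
    rw [List.getElem?_take_of_lt hi, h1, List.getElem?_map, List.getElem?_range hi]
    rfl
  · rw [List.getElem?_eq_none (by simpa using hi), List.getElem?_eq_none]
    rw [List.length_take]
    omega

theorem length_flatMap_le {α β : Type} (l : List α) (f : α → List β) (M : ℕ)
    (h : ∀ a ∈ l, (f a).length ≤ M) : (l.flatMap f).length ≤ l.length * M := by
  induction l with
  | nil => simp
  | cons a l ih =>
    rw [List.flatMap_cons, List.length_append, List.length_cons, add_mul, one_mul, add_comm]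
    exact Nat.add_le_add (ih fun b hb => h b (List.mem_cons_of_mem _ hb))
      (h a List.mem_cons_self)

theorem length_attempt (d L : ℕ) (hd : 1 ≤ d) (hL : 1 ≤ L) :
    (attempt d L).length ≤ 17 * (d * L) := by
  have h1 := length_flatMap_le (List.range L) (electBit d) (d + 2)
    (by simp [electBit, waves])
  have h2 := length_flatMap_le (List.range L) (fun _ => phase d) (2 * d + 2)
    (by simp [phase, labels, convs]; omega)
  rw [List.length_range] at h1 h2
  have h3 : (attempt d L).length = ((List.range L).flatMap (electBit d)).length +
      ((List.range L).flatMap fun _ => phase d).length + 4 * d + 6 := by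
    simp only [attempt, attemptWork, setup, elect, treeWork, waves, convs, List.length_append,
      List.length_cons, List.length_map, List.length_range, List.length_nil, List.length_reverse]
    omega
  -- The length is at most `L * (d + 2) + L * (2 * d + 2) + 4 * d + 6`; its coefficients `3 + 4 + 4
  -- + 6` add up to 17.
  nlinarith [Nat.mul_le_mul hd hL]

/-! ### The algorithm and its complexity -/

/-- The initial registers; a vertex without neighbours stops at once. -/
def initReg (N : Finset ℕ) : Reg where
  wave := ⟨none, 0, 0⟩
  alive := False
  dep := none
  par := 0
  sz := 0
  csz := fun _ => none
  lab := 0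
  lo := 0
  hi := 0
  link := fun _ _ => False
  out := if N = ∅ then some false else none

/-- The cut vertex algorithm. -/
noncomputable def cutVertexAlg : DistAlg := streamAlg rounds initReg Reg.out

instance {V : Type} : MeasureTheory.IsProbabilityMeasure (coinMeasure V) := by
  unfold coinMeasure
  infer_instance

section Network

variable {V : Type} [Fintype V] {G : SimpleGraph V} {ident : V → ℕ}

theorem streamExec_rounds {k : ℕ} {F : List (Step Reg)} (hF : F <+: schedule k) {t : ℕ}
    (ht : t ≤ F.length) : streamExec G ident rounds initReg t =
      exec G ident (F.take t) fun v => initReg (nbrIds G ident v) := by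
  rw [streamExec, map_rounds hF ht]

/-- An execution in which all vertices produce correct outputs in round `F.length` satisfies all
requirements. -/
theorem cutVertexAlg_spec (hid : Function.Injective ident) {k : ℕ} {F : List (Step Reg)}
    (hF : F <+: schedule k)
    (h0 : ∀ t < F.length, ∀ v,
      (exec G ident (F.take t) (fun v => initReg (nbrIds G ident v)) v).out = none)
    (h1 : ∀ v, ∃ b, (exec G ident F (fun v => initReg (nbrIds G ident v)) v).out = some b ∧
      (b = true ↔ IsCutVertex G v))
    {M B T : ℕ} (hm : MsgBound G ident F (fun v => initReg (nbrIds G ident v)) M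
      fun m => m.size ≤ B) (hT : F.length ≤ T) :
    (∀ (ω : Coins V) (t : ℕ) (u v : V) (m : List Bool),
      cutVertexAlg.sent G ident ω t u v = some m → m.length ≤ B) ∧
    (∀ (ω : Coins V) (v : V), ∃ b, cutVertexAlg.output (cutVertexAlg.run G ident ω T v) = some b ∧
      (b = true ↔ IsCutVertex G v)) ∧
    (∀ (ω : Coins V) (T' : ℕ) (u v : V), cutVertexAlg.traffic G ident ω T' u v ≤ 2 * M) := by
  have e0 : ∀ t < F.length, ∀ v, (streamExec G ident rounds initReg t v).out = none := by
    intro t ht v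
    rw [streamExec_rounds hF ht.le]
    exact h0 t ht v
  have hF' : (List.range F.length).map rounds = F := by
    rw [map_rounds hF le_rfl, List.take_length]
  have e1 : ∀ v, ∃ b, (streamExec G ident rounds initReg F.length v).out = some b ∧
      (b = true ↔ IsCutVertex G v) := by
    intro v
    rw [streamExec, hF']
    exact h1 v
  have e1' : ∀ v, (streamExec G ident rounds initReg F.length v).out ≠ none := by
    intro v
    obtain ⟨b, hb, -⟩ := e1 v
    rw [hb]; simp
  refine ⟨fun ω t u v m h => ?_, fun ω v => ?_, fun ω T' u v => ?_⟩
  · rw [cutVertexAlg, sent_stream G rounds initReg Reg.out hid ω _ e0 e1'] at h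
    split_ifs at h with ht
    obtain ⟨x, hx, rfl⟩ := Option.map_eq_some_iff.1 h
    have := mem_msgs_stream G rounds initReg _ u v x t ht hx
    rw [hF'] at this
    rw [Nat.size_eq_bits_len]
    exact (hm u v).2 x this
  · rw [cutVertexAlg, run_stream_of_le G rounds initReg Reg.out hid ω _ e0 e1' T hT]
    exact e1 v
  · refine (traffic_stream_le G rounds initReg Reg.out hid ω _ e0 e1' T' u v).trans ?_
    rw [hF', two_mul]
    exact Nat.add_le_add (hm u v).1 (hm v u).1

theorem diam_lt_card (hG : G.Connected) : G.diam < Fintype.card V := by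
  have := hG.nonempty
  obtain ⟨u, v, huv⟩ := G.exists_dist_eq_diam
  obtain ⟨p, hp⟩ := hG.exists_walk_length_eq_dist u v
  rw [← huv, ← hp]
  exact (p.isPath_of_length_eq_dist hp).length_lt

theorem diam_pos (hG : G.Connected) [Nontrivial V] : 1 ≤ G.diam := by
  obtain ⟨u, v, huv⟩ := exists_pair_ne V
  exact (hG.pos_dist_of_ne huv).trans_le
    (SimpleGraph.dist_le_diam (SimpleGraph.connected_iff_ediam_ne_top.1 hG))

/-- The execution on a graph with at least two vertices. -/
theorem exists_execution (hid : Function.Injective ident) (hG : G.Connected) [Nontrivial V]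
    (a l : ℕ) (hl : l = Nat.log 2 (Fintype.card V) + 1) (ha : ∀ v, (ident v).size ≤ a * l) :
    ∃ k F M, F <+: schedule k ∧ (∀ t < F.length, ∀ v,
      (exec G ident (F.take t) (fun v => initReg (nbrIds G ident v)) v).out = none) ∧
    (∀ v, ∃ b, (exec G ident F (fun v => initReg (nbrIds G ident v)) v).out = some b ∧
      (b = true ↔ IsCutVertex G v)) ∧
    MsgBound G ident F (fun v => initReg (nbrIds G ident v)) M
      (fun m => m.size ≤ (a + 2) * l) ∧
    F.length ≤ 68 * (a + 3) ^ 3 * G.diam * l ^ 3 ∧ 2 * M ≤ 68 * (a + 3) ^ 3 * l ^ 3 := by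
  have hD := diam_pos hG
  have hDn := diam_lt_card hG
  have hl1 : 1 ≤ l := by omega
  set D := G.diam with hDdef
  -- The pair `(2 ^ i, 2 ^ j)` overshoots `D` and `m` by a factor of at most two each, so a trial
  -- succeeds no later than in group `i + j`, where `2 ^ (i + j) ≤ 4 * (D * m)`. Taking `a + 1`
  -- keeps `m` positive when `a = 0`.
  set m := (a + 1) * l with hm
  have hm1 : 1 ≤ m := Nat.one_le_iff_ne_zero.2 (by positivity)
  set i := Nat.log 2 D + 1 with hi
  set j := Nat.log 2 m + 1 with hj
  have hDi : D ≤ 2 ^ i := (Nat.lt_pow_succ_log_self (by norm_num) D).le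
  have hiD : 2 ^ i ≤ 2 * D := by
    rw [hi, pow_succ, mul_comm]
    exact Nat.mul_le_mul_left 2 (Nat.pow_log_le_self 2 (by omega))
  have hmj : m ≤ 2 ^ j := (Nat.lt_pow_succ_log_self (by norm_num) m).le
  have hjm : 2 ^ j ≤ 2 * m := by
    rw [hj, pow_succ, mul_comm]
    exact Nat.mul_le_mul_left 2 (Nat.pow_log_le_self 2 (by omega))
  have hil : i ≤ l := by
    rw [hi, hl]
    exact Nat.succ_le_succ (Nat.log_mono_right hDn.le)
  have hjm' : j ≤ m := Nat.log_lt_self 2 (by omega)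
  set k := i + j with hk
  have hk2 : 2 ^ k ≤ 4 * (D * m) := by
    rw [hk, pow_add]
    calc 2 ^ i * 2 ^ j ≤ (2 * D) * (2 * m) := Nat.mul_le_mul hiD hjm
      _ = 4 * (D * m) := by ring
  have hk1 : k + 1 ≤ (a + 3) * l := by
    have : (a + 3) * l = l + m + l := by rw [hm]; ring
    omega
  have hmem : ∃ p ∈ params (k + 1), D ≤ p.1 ∧ a * l ≤ p.2 := by
    refine ⟨(2 ^ i, 2 ^ j), ?_, hDi, le_trans ?_ hmj⟩
    · simp only [params, List.mem_flatMap, List.mem_range, List.mem_map]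
      exact ⟨k, by omega, j, by omega, by rw [hk, Nat.add_sub_cancel]⟩
    · rw [hm]; exact Nat.mul_le_mul_right l (by omega)
  have hinit : ∀ v, (initReg (nbrIds G ident v)).out = none := by
    intro v
    have : nbrIds G ident v ≠ ∅ := by
      obtain ⟨w, hw⟩ := hG.preconnected.exists_adj_of_nontrivial v
      exact Finset.ne_empty_of_mem ((mem_nbrIds G hid w v).2 hw)
    simp [initReg, this]
  obtain ⟨l₁, p, l₂, e1, e2, F, hF, e3, e4, e5⟩ := exists_first_success hid hG ha
    (B := (a + 2) * l) (Nat.mul_le_mul_right l (by omega))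
    (by rw [← hl]; exact Nat.mul_le_mul_right l (by omega)) (params (k + 1)) hmem
    (fun v => initReg (nbrIds G ident v)) hinit
  have hsub : ∀ p' ∈ l₁ ++ [p], p' ∈ params (k + 1) := fun p' hp' => by
    rw [e1]; exact List.mem_append_left _ hp'
  have hlen : l₁.length + 1 ≤ ((a + 3) * l) ^ 2 := by
    have h1 := length_params (k + 1)
    have h2 : (params (k + 1)).length = l₁.length + 1 + l₂.length := by
      rw [e1]; simp; omega
    have h3 := Nat.pow_le_pow_left hk1 2
    omega
  refine ⟨k + 1, F, _, ?_, e3, e4, e5, ?_, ?_⟩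
  · rw [schedule, e1, hF]
    exact ⟨_, List.flatMap_append.symm⟩
  · have h1 : F.length ≤ (l₁ ++ [p]).length * (17 * (4 * (D * m))) := by
      rw [hF]
      refine length_flatMap_le _ _ _ fun p' hp' => ?_
      obtain ⟨h1, h2, h3⟩ := mem_params (hsub p' hp')
      exact (length_attempt p'.1 p'.2 h1 h2).trans (Nat.mul_le_mul_left 17 (h3.trans hk2))
    rw [List.length_append, List.length_singleton] at h1
    calc F.length ≤ (l₁.length + 1) * (17 * (4 * (D * m))) := h1
      _ ≤ ((a + 3) * l) ^ 2 * (17 * (4 * (D * ((a + 3) * l)))) := by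
        have : m ≤ (a + 3) * l := Nat.mul_le_mul_right l (by omega)
        gcongr
      _ = 68 * (a + 3) ^ 3 * D * l ^ 3 := by ring
  · obtain ⟨h1, h2, h3⟩ := mem_params (hsub p (by simp))
    -- The successful pair may be lopsided, but success gives `D ≤ 2 * p.1`; cancelling `p.1` in
    -- `p.1 * p.2 ≤ 4 * (D * m)` bounds `p.2` independently of `D`.
    have hL : p.2 ≤ 8 * m := by
      have : p.1 * p.2 ≤ p.1 * (8 * m) :=
        calc p.1 * p.2 ≤ 4 * (D * m) := h3.trans hk2
          _ ≤ 4 * ((2 * p.1) * m) := by gcongr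
          _ = p.1 * (8 * m) := by ring
      exact Nat.le_of_mul_le_mul_left this h1
    have h4 : a * l + 3 ≤ (a + 3) * l := by nlinarith
    have h5 : a * l + 4 + 3 * p.2 ≤ 25 * ((a + 3) * l) := by
      have : 3 * p.2 ≤ 24 * m := by omega
      have : m + 2 * l = (a + 3) * l := by rw [hm]; ring
      nlinarith
    have h6 : (a + 3) * l ≤ ((a + 3) * l) ^ 3 := Nat.le_self_pow (by norm_num) _
    calc 2 * (l₁.length * (a * l + 3) + (a * l + 4 + 3 * p.2))
        ≤ 2 * (((a + 3) * l) ^ 2 * ((a + 3) * l) + 25 * ((a + 3) * l)) := by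
          gcongr
          omega
      _ ≤ 2 * (((a + 3) * l) ^ 3 + 25 * ((a + 3) * l) ^ 3) := by
          rw [← pow_succ]
          gcongr
      _ ≤ 68 * ((a + 3) * l) ^ 3 := by omega
      _ = 68 * (a + 3) ^ 3 * l ^ 3 := by ring

end Network

theorem theorem1 :
    ∃ k : ℕ, ∀ a : ℕ, ∃ B : ℕ, ∀ c : ℕ, ∃ (A : DistAlg) (C : ℕ),
      ∀ (V : Type) [Fintype V] (G : SimpleGraph V) (ident : V → ℕ),
        G.Connected → Function.Injective ident →
        (∀ v, (ident v).size ≤ a * (Nat.log 2 (Fintype.card V) + 1)) →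
        -- every message has `O(log n)` bits
        (∀ (ω : Coins V) (t : ℕ) (u v : V) (m : List Bool), A.sent G ident ω t u v = some m →
          m.length ≤ B * (Nat.log 2 (Fintype.card V) + 1)) ∧
        -- every vertex stops within `Õ(D)` rounds
        (∀ (ω : Coins V) (v : V), (A.output (A.run G ident ω
          (C * G.diam * (Nat.log 2 (Fintype.card V) + 1) ^ k) v)).isSome) ∧
        -- the edge congestion is `Õ(1)`
        (∀ (ω : Coins V) (T : ℕ) (u v : V), G.Adj u v →
          A.traffic G ident ω T u v ≤ C * (Nat.log 2 (Fintype.card V) + 1) ^ k) ∧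
        -- with high probability every vertex knows whether it is a cut vertex
        1 - 1 / (Fintype.card V : ℝ) ^ c ≤ (coinMeasure V).real
          {ω | ∀ v, ∃ b : Bool, A.output (A.run G ident ω
            (C * G.diam * (Nat.log 2 (Fintype.card V) + 1) ^ k) v) = some b ∧
              (b = true ↔ IsCutVertex G v)} := by
  -- Exponent 3: two logarithmic factors for the number of trials, one for the length of a trial. In
  -- `a + 2`, the 2 covers the pairs of labels and the `a` the identifiers.
  refine ⟨3, fun a => ⟨a + 2, fun c => ⟨cutVertexAlg, 68 * (a + 3) ^ 3, ?_⟩⟩⟩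
  intro V _ G ident hG hid ha
  set l := Nat.log 2 (Fintype.card V) + 1 with hl
  have key : (∀ (ω : Coins V) (t : ℕ) (u v : V) (m : List Bool),
      cutVertexAlg.sent G ident ω t u v = some m → m.length ≤ (a + 2) * l) ∧
    (∀ (ω : Coins V) (v : V), ∃ b, cutVertexAlg.output
      (cutVertexAlg.run G ident ω (68 * (a + 3) ^ 3 * G.diam * l ^ 3) v) = some b ∧
      (b = true ↔ IsCutVertex G v)) ∧
    (∀ (ω : Coins V) (T : ℕ) (u v : V),
      cutVertexAlg.traffic G ident ω T u v ≤ 68 * (a + 3) ^ 3 * l ^ 3) := by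
    rcases subsingleton_or_nontrivial V with hV | hV
    -- On a single vertex the diameter is 0, so no rounds are allowed and the output must already be
    -- present in the initial registers.
    · have hnb : ∀ v, nbrIds G ident v = ∅ := by
        intro v
        refine Finset.eq_empty_of_forall_notMem fun m hm => ?_
        obtain ⟨u, hu, -⟩ := exists_of_mem_nbrIds hm
        exact hu.ne (Subsingleton.elim _ _)
      have := cutVertexAlg_spec (G := G) hid (k := 0) (F := []) List.nil_prefix (by simp)
        (fun v => ⟨false, by simp [initReg, hnb], by
          simp only [Bool.false_eq_true, false_iff, IsCutVertex, not_not]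
          exact fun u w => Subsingleton.elim u w ▸ .refl _⟩) (B := (a + 2) * l) MsgBound.nil
        (T := 68 * (a + 3) ^ 3 * G.diam * l ^ 3) (Nat.zero_le _)
      exact ⟨this.1, this.2.1, fun ω T u v => (this.2.2 ω T u v).trans (Nat.zero_le _)⟩
    · obtain ⟨k, F, M, h1, h2, h3, h4, h5, h6⟩ := exists_execution hid hG a l hl ha
      have := cutVertexAlg_spec hid h1 h2 h3 h4 h5
      exact ⟨this.1, this.2.1, fun ω T u v => (this.2.2 ω T u v).trans h6⟩
  obtain ⟨h1, h2, h3⟩ := key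
  refine ⟨h1, fun ω v => ?_, fun ω T u v _ => h3 ω T u v, ?_⟩
  · obtain ⟨b, hb, -⟩ := h2 ω v
    rw [hb]; rfl
  -- Every outcome of the coins is good, so the event has probability 1.
  · rw [Set.eq_univ_of_forall (s := {ω | _}) fun ω v => h2 ω v]
    simp
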